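/- Let $K$ be a field, $R=K[[x_1,\dots,x_n]]$ with maximal ideal $\mathfrak m$, and let $\mathrm{Aut}(R)$ be the group of $K$-algebra automorphisms of $R$ under composition, $(g\circ h)(f)=g(h(f))$. For ideals $J_1,\dots,J_s$ of $R$ let $G(J_1,\dots,J_s)=\{g\in\mathrm{Aut}(R): g(J_k)=J_k \text{ for all } k\}$. Let $I_1,\dots,I_r$ be monomial ideals of finite colength in $R$. For $1\le i\le n$ let $A_i$ be the ideal generated by the images $g(x_i)$ of $x_i$ under all $g\in G(I_1,\dots,I_r)$ with $g(x_j)=x_j$ for every $j\ne i$. Let $$\mathfrak m^2\subsetneq B_1\subsetneq\dots\subsetneq B_m=\mathfrak m$$ be a nested sequence of monomial ideals with $G(A_1,\dots,A_n)\subset G(B_1,\dots,B_m)$, where $m\geq 1$ is the largest possible among all such sequences, and put $G(B)=G(B_1,\dots,B_m)$. Write $x_j\le x_i$ if every $B_k$ containing $x_i$ contains $x_j$, and $x_j<x_i$ if $x_j\le x_i$ but not $x_i\le x_j$. Let $\mathcal I$ be the set of pairs $(i,v)$, with $1\le i\le n$ and $v\in\mathbb Z_{\ge 0}^n$, such that $x^v\notin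 A_i$ and such that, if $|v|=1$, then $x^v<x_i$. Let $\mathcal S$ be the set of automorphisms $g\in\mathrm{Aut}(R)$ for which there are $a_{i,v}\in K$ (finitely many nonzero) such that $$g(x_i)=x_i+\sum_{v:\,(i,v)\in\mathcal I}a_{i,v}\,x^v\qquad\text{for } i=1,\dots,n.$$ Then $\mathcal S$ is a set of representatives for the cosets $f\circ G(A_1,\dots,A_n)$, $f\in G(B)$: we have $\mathcal S\subset G(B)$, and for every $f\in G(B)$ there is exactly one $g\in\mathcal S$ such that $f=g\circ h$ for some $h\in G(A_1,\dots,A_n)$. -/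

import Mathlib

open MvPowerSeries

namespace Alignment

/-- The formal power series ring `R = K[[x_1, …, x_n]]`. -/
abbrev PS (n : ℕ) (K : Type*) [Field K] : Type _ := MvPowerSeries (Fin n) K

/-- The group `Aut(R)` of `K`-algebra automorphisms of `R`; the product is composition,
`(g * h) f = g (h f)`. -/
abbrev Aut (n : ℕ) (K : Type*) [Field K] : Type _ := PS n K ≃ₐ[K] PS n K

section

variable {n : ℕ} {K : Type*} [Field K]

/-- The monomial `x^v`. -/
noncomputable def mono (K : Type*) [Field K] (v : Fin n →₀ ℕ) : PS n K := monomial v 1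

/-- Ideals generated by monomials. -/
def IsMonomial (J : Ideal (PS n K)) : Prop :=
  ∃ T : Set (Fin n →₀ ℕ), J = Ideal.span (mono K '' T)

/-- The automorphism `g` sends the ideal `J` onto itself. -/
def Fixes (g : Aut n K) (J : Ideal (PS n K)) : Prop :=
  J.map (g : PS n K →+* PS n K) = J

/-- The group `G(J_1, …, J_s)` of automorphisms of `R` fixing each of the ideals `J_k`. -/
noncomputable def G {ι : Type*} (J : ι → Ideal (PS n K)) : Subgroup (Aut n K) where
  carrier := {g | ∀ k, Fixes g (J k)}
  one_mem' := fun k => Ideal.map_id (J k)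
  mul_mem' := by
    intro a b ha hb k
    have h := Ideal.map_map (I := J k) (b : PS n K →+* PS n K) (a : PS n K →+* PS n K)
    have hb' : (J k).map (b : PS n K →+* PS n K) = J k := hb k
    have ha' : (J k).map (a : PS n K →+* PS n K) = J k := ha k
    rw [hb', ha'] at h
    exact h.symm
  inv_mem' := by
    intro a ha k
    have h := Ideal.map_map (I := J k) (a : PS n K →+* PS n K)
      ((a⁻¹ : Aut n K) : PS n K →+* PS n K)
    have ha' : (J k).map (a : PS n K →+* PS n K) = J k := ha k
    have hc : ((a⁻¹ : Aut n K) : PS n K →+* PS n K).comp (a : PS n K →+* PS n K)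
        = RingHom.id _ := by
      ext1 x
      exact a.symm_apply_apply x
    rw [ha', hc, Ideal.map_id] at h
    exact h

/-- The measuring sequence `A_1, …, A_n` of the ideals `I_1, …, I_r`: the ideal `A_i` is generated
by the images of `x_i` under the automorphisms of `R` which fix every `x_j` with `j ≠ i` and send
each `I_k` to itself. -/
noncomputable def measuring {r : ℕ} (I : Fin r → Ideal (PS n K)) (i : Fin n) : Ideal (PS n K) :=
  Ideal.span {f | ∃ g : Aut n K, (∀ j, j ≠ i → g (X j) = X j) ∧ (∀ k, Fixes g (I k)) ∧ g (X i) = f}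

/-- A nested sequence `𝔪² ⊊ B_0 ⊊ ⋯ ⊊ B_m = 𝔪` of monomial ideals such that
`G(A_1, …, A_n) ⊆ G(B_0, …, B_m)`. -/
structure IsChain (A : Fin n → Ideal (PS n K)) {m : ℕ} (B : Fin (m + 1) → Ideal (PS n K)) :
    Prop where
  isMonomial : ∀ k, IsMonomial (B k)
  sq_lt : IsLocalRing.maximalIdeal (PS n K) ^ 2 < B 0
  strictMono : StrictMono B
  last_eq : B (Fin.last m) = IsLocalRing.maximalIdeal (PS n K)
  le : G A ≤ G B

/-- Such a nested sequence with the greatest possible number of terms. -/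
structure IsMaxChain (A : Fin n → Ideal (PS n K)) {m : ℕ} (B : Fin (m + 1) → Ideal (PS n K)) :
    Prop extends IsChain A B where
  maximal : ∀ (m' : ℕ) (B' : Fin (m' + 1) → Ideal (PS n K)), IsChain A B' → m' ≤ m

/-- The (non-strict) total ordering on the variables given by the chain `B`:
`x_i ≤ x_j` when each `B_k` that contains `x_j` contains `x_i`. -/
def VarLE {ι : Type*} (B : ι → Ideal (PS n K)) (i j : Fin n) : Prop :=
  ∀ k, (X j : PS n K) ∈ B k → (X i : PS n K) ∈ B k

/-- `x_i < x_j`: `x_i ≤ x_j` and the two variables are not equivalent. -/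
def VarLT {ι : Type*} (B : ι → Ideal (PS n K)) (i j : Fin n) : Prop :=
  VarLE B i j ∧ ¬ VarLE B j i

/-- The set of pairs `(i, v)` such that `x^v ∉ A_i` and, if `|v| = 1`, so that `x^v` is a
variable `x_j`, then `x_j < x_i`. -/
def pairs {ι : Type*} (A : Fin n → Ideal (PS n K)) (B : ι → Ideal (PS n K)) :
    Set (Fin n × (Fin n →₀ ℕ)) :=
  {q | mono K q.2 ∉ A q.1 ∧ ∀ j, q.2 = Finsupp.single j 1 → VarLT B j q.1}

/-- The set of automorphisms `g` of the form `g(x_i) = x_i + ∑ a_{i,v} x^v`, where for each `i` the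
sum runs over the `v` with `(i, v) ∈ pairs A B`. -/
def reps {ι : Type*} (A : Fin n → Ideal (PS n K)) (B : ι → Ideal (PS n K)) : Set (Aut n K) :=
  {g | ∃ a : Fin n → (Fin n →₀ ℕ) →₀ K,
    (∀ i, ∀ v ∈ (a i).support, (i, v) ∈ pairs A B) ∧
    ∀ i, g (X i) = X i + (a i).sum fun v c => c • mono K v}

end

end Alignment

/-! Give `x_i` the weight `2 * m + 1 - level B i`, where `level B i` is the first index `k` with
`x_i ∈ B k`. All weights lie between `m + 1` and `2 * m + 1`, so a product of two variables
outweighs every variable, and `x_j` outweighs `x_i` exactly when `x_j < x_i`. Hence the members of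
`reps` are unipotent: they change each variable by terms of larger weight only. Such an automorphism
preserves the lowest weight part of every power series, and this drives both halves of the proof.

Uniqueness (`reps_unique`): if `g' = g * h` with `h ∈ G A`, then `h x_i - x_i` lies in the monomial
ideal `A_i`, while its image under `g`, namely `g' x_i - g x_i`, involves only monomials outside
`A_i`. Both have the same lowest weight part, so there is none.

Existence: the linear part of `f ∈ G B` is block triangular with respect to the levels, with
invertible diagonal blocks. Maximality of the chain forces `x_j ∈ A_i` for variables of equal level,
since otherwise one more ideal could be inserted (`IsMaxChain.X_mem_of_level_eq`). So `G A` contains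
the general linear group of each level, and `f` becomes unipotent after multiplication on the right
(`exists_isUnipotent`). The monomials of `A_i` are then cleared from `f x_i - x_i` in order of
increasing weight by elementary elements of `G A` (`exists_reduced`). Beyond a finite weight every
monomial lies in all `A_i`, and the remaining tail is absorbed by an automorphism congruent to the
identity modulo each `A_i` (`exists_mem_reps`).

The supply of elements of `G A` comes from the structure of the measuring sequence: `A_i` is
generated by `x_i` and the monomials `x^v` free of `x_i` for which `x_i ↦ x_i + c x^v` preserves
every `I_k` (`measuring_eq_span`), and these maps preserve every `A_j` as well
(`isMeasuring_of_containsDegree`). -/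

namespace Alignment

/-! ### Monomial ideals and automorphisms preserving them -/

section Basics

variable {n : ℕ} {K : Type*} [Field K]

theorem mono_zero : mono K (0 : Fin n →₀ ℕ) = 1 := rfl

theorem mono_add (u v : Fin n →₀ ℕ) : mono K (u + v) = mono K u * mono K v := by
  simp [mono, monomial_mul_monomial]

theorem mono_single (i : Fin n) : mono K (Finsupp.single i 1) = X i := rfl

theorem mono_nsmul (k : ℕ) (v : Fin n →₀ ℕ) : mono K (k • v) = mono K v ^ k := by
  induction k with
  | zero => simp [mono_zero]
  | succ k ih => rw [succ_nsmul, mono_add, ih, pow_succ]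

theorem coeff_mono (u v : Fin n →₀ ℕ) :
    coeff u (mono K v) = if u = v then 1 else 0 := by
  rw [mono, coeff_monomial]

theorem mono_mem_of_le {J : Ideal (PS n K)} {u v : Fin n →₀ ℕ} (h : u ≤ v) (hu : mono K u ∈ J) :
    mono K v ∈ J := by
  rw [← tsub_add_cancel_of_le h, mono_add]
  exact J.mul_mem_left _ hu

/-- The ideal of power series supported in an upper set of exponents. -/
def supportedIdeal (E : Set (Fin n →₀ ℕ)) (hE : IsUpperSet E) : Ideal (PS n K) where
  carrier := {f | ∀ v, coeff v f ≠ 0 → v ∈ E}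
  zero_mem' := fun v hv => absurd (coeff_zero v) hv
  add_mem' := by
    intro a b ha hb v hv
    rw [map_add] at hv
    by_cases h : coeff v a = 0
    · exact hb v (by simpa [h] using hv)
    · exact ha v h
  smul_mem' := by
    classical
    intro c f hf v hv
    rw [smul_eq_mul, coeff_mul] at hv
    obtain ⟨p, hp, hne⟩ := Finset.exists_ne_zero_of_sum_ne_zero hv
    rw [Finset.HasAntidiagonal.mem_antidiagonal] at hp
    exact hE (hp ▸ le_add_self) (hf p.2 (right_ne_zero_of_mul hne))

theorem mem_supportedIdeal {E : Set (Fin n →₀ ℕ)} {hE : IsUpperSet E} {f : PS n K} :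
    f ∈ supportedIdeal E hE ↔ ∀ v, coeff v f ≠ 0 → v ∈ E := Iff.rfl

theorem mono_mem_supportedIdeal {E : Set (Fin n →₀ ℕ)} {hE : IsUpperSet E} {v : Fin n →₀ ℕ} :
    mono K v ∈ supportedIdeal E hE ↔ v ∈ E := by
  classical
  rw [mem_supportedIdeal]
  constructor
  · intro h
    exact h v (by simp [coeff_mono])
  · intro h u hu
    rw [coeff_mono] at hu
    split_ifs at hu with h'
    · exact h' ▸ h
    · exact absurd rfl hu

theorem mem_span_mono_of_finite (T : Finset (Fin n →₀ ℕ)) :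
    ∀ f : PS n K, (∀ v, coeff v f ≠ 0 → ∃ t ∈ T, t ≤ v) →
      f ∈ Ideal.span (mono K '' (T : Set (Fin n →₀ ℕ))) := by
  classical
  induction T using Finset.induction_on with
  | empty =>
    intro f hf
    have : f = 0 := by
      ext v
      by_contra h
      obtain ⟨t, ht, -⟩ := hf v h
      simp at ht
    rw [this]
    exact zero_mem _
  | insert t T ht ih =>
    intro f hf
    -- The terms of `f` divisible by `x^t` add up to `q * x^t`; what remains needs only the
    -- generators from `T`.
    let q : PS n K := fun v => coeff (v + t) f
    have hq : ∀ v, coeff v q = coeff (v + t) f := fun v => rfl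
    have hle : Ideal.span (mono K '' (T : Set (Fin n →₀ ℕ))) ≤
        Ideal.span (mono K '' ((insert t T : Finset _) : Set (Fin n →₀ ℕ))) :=
      Ideal.span_mono (Set.image_mono (by simp))
    have h1 : f - q * mono K t ∈ Ideal.span (mono K '' (T : Set (Fin n →₀ ℕ))) := by
      apply ih
      intro v hv
      rw [map_sub, mono, coeff_mul_monomial, mul_one] at hv
      split_ifs at hv with h
      · rw [hq, tsub_add_cancel_of_le h, sub_self] at hv
        exact absurd rfl hv
      · rw [sub_zero] at hv
        obtain ⟨s, hs, hsv⟩ := hf v hv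
        rcases Finset.mem_insert.1 hs with rfl | hs
        · exact absurd hsv h
        · exact ⟨s, hs, hsv⟩
    have h2 : q * mono K t ∈
        Ideal.span (mono K '' ((insert t T : Finset _) : Set (Fin n →₀ ℕ))) :=
      Ideal.mul_mem_left _ _ (Ideal.subset_span ⟨t, by simp, rfl⟩)
    have := Ideal.add_mem _ (hle h1) h2
    rwa [sub_add_cancel] at this

/-- Dickson's lemma: the minimal elements of `T` form an antichain in a well-quasi-order. -/
theorem exists_finset_le (T : Set (Fin n →₀ ℕ)) :
    ∃ S : Finset (Fin n →₀ ℕ), (S : Set _) ⊆ T ∧ ∀ t ∈ T, ∃ s ∈ S, s ≤ t := by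
  have hfin : {t | Minimal (· ∈ T) t}.Finite :=
    (IsAntichain.finite_of_wellQuasiOrdered (setOfPred_minimal_antichain _)
      WellQuasiOrderedLE.wqo)
  refine ⟨hfin.toFinset, ?_, ?_⟩
  · intro t ht
    rw [Set.Finite.coe_toFinset] at ht
    exact ht.prop
  · intro t ht
    obtain ⟨s, hs, hmin⟩ := exists_minimal_le_of_wellFoundedLT (· ∈ T) t ht
    exact ⟨s, by simpa using hmin, hs⟩

/-- Dickson's lemma reduces to finitely many generators, so infinitely many terms of `f` still give
a finite combination. This lets later arguments check ideals on monomials without any topology. -/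
theorem mem_span_mono {T : Set (Fin n →₀ ℕ)} {f : PS n K} :
    f ∈ Ideal.span (mono K '' T) ↔ ∀ v, coeff v f ≠ 0 → ∃ t ∈ T, t ≤ v := by
  constructor
  · intro hf
    have hE : IsUpperSet {v : Fin n →₀ ℕ | ∃ t ∈ T, t ≤ v} := by
      rintro a b hab ⟨t, ht, hta⟩
      exact ⟨t, ht, hta.trans hab⟩
    have : Ideal.span (mono K '' T) ≤ supportedIdeal _ hE := by
      rw [Ideal.span_le]
      rintro _ ⟨t, ht, rfl⟩
      exact mono_mem_supportedIdeal.2 ⟨t, ht, le_rfl⟩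
    exact this hf
  · intro hf
    obtain ⟨S, hST, hS⟩ := exists_finset_le T
    refine Ideal.span_mono (Set.image_mono hST) (mem_span_mono_of_finite S f ?_)
    intro v hv
    obtain ⟨t, ht, htv⟩ := hf v hv
    obtain ⟨s, hs, hst⟩ := hS t ht
    exact ⟨s, hs, hst.trans htv⟩

theorem supportedIdeal_eq_span {E : Set (Fin n →₀ ℕ)} (hE : IsUpperSet E) :
    supportedIdeal E hE = Ideal.span (mono K '' E) := by
  ext f
  rw [mem_supportedIdeal, mem_span_mono]
  refine forall₂_congr fun v _ => ⟨fun h => ⟨v, h, le_rfl⟩, ?_⟩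
  rintro ⟨t, ht, htv⟩
  exact hE htv ht

theorem isMonomial_supportedIdeal (E : Set (Fin n →₀ ℕ)) (hE : IsUpperSet E) :
    IsMonomial (supportedIdeal (K := K) E hE) :=
  ⟨E, supportedIdeal_eq_span hE⟩

theorem IsMonomial.mem_iff {J : Ideal (PS n K)} (hJ : IsMonomial J) {f : PS n K} :
    f ∈ J ↔ ∀ v, coeff v f ≠ 0 → mono K v ∈ J := by
  obtain ⟨T, rfl⟩ := hJ
  rw [mem_span_mono]
  refine forall₂_congr fun v _ => ⟨?_, fun h => ?_⟩
  · rintro ⟨t, ht, htv⟩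
    exact mono_mem_of_le htv (Ideal.subset_span ⟨t, ht, rfl⟩)
  · classical
    exact mem_span_mono.1 h v (by simp [coeff_mono])

theorem IsMonomial.eq_span {J : Ideal (PS n K)} (hJ : IsMonomial J) :
    J = Ideal.span (mono K '' {v | mono K v ∈ J}) := by
  obtain ⟨T, rfl⟩ := hJ
  apply le_antisymm
  · exact Ideal.span_mono (Set.image_mono fun t ht => Ideal.subset_span ⟨t, ht, rfl⟩)
  · rw [Ideal.span_le]
    rintro _ ⟨t, ht, rfl⟩
    exact ht

/-- A ring homomorphism maps a monomial ideal into an ideal as soon as it maps its monomials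
there. -/
theorem IsMonomial.map_mem {J J' : Ideal (PS n K)} (hJ : IsMonomial J) (φ : PS n K →+* PS n K)
    (h : ∀ v, mono K v ∈ J → φ (mono K v) ∈ J') {f : PS n K} (hf : f ∈ J) : φ f ∈ J' := by
  have : J ≤ J'.comap φ := by
    rw [hJ.eq_span, Ideal.span_le]
    rintro _ ⟨v, hv, rfl⟩
    exact h v hv
  exact this hf

theorem Fixes.map_mem {g : Aut n K} {J : Ideal (PS n K)} (h : Fixes g J) {f : PS n K}
    (hf : f ∈ J) : g f ∈ J := by
  have : (g : PS n K →+* PS n K) f ∈ J.map (g : PS n K →+* PS n K) := Ideal.mem_map_of_mem _ hf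
  rw [h] at this
  exact this

theorem fixes_of_map_mem {g : Aut n K} {J : Ideal (PS n K)} (h : ∀ f ∈ J, g f ∈ J) :
    Fixes g J := by
  apply le_antisymm
  · rw [Ideal.map_le_iff_le_comap]
    exact h
  · intro y hy
    -- The preimages of `J` under the powers of `g` form an ascending chain. Once it is stationary,
    -- applying `g ^ N` shows that the preimage of `J` under `g` is `J` itself.
    let s : ℕ →o Ideal (PS n K) :=
      { toFun := fun k => J.comap ((g ^ k : Aut n K) : PS n K →+* PS n K)
        monotone' := by
          refine monotone_nat_of_le_succ fun k f hf => ?_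
          change (g ^ (k + 1)) f ∈ J
          rw [pow_succ']
          exact h _ hf }
    obtain ⟨N, hN⟩ := monotone_stabilizes_iff_noetherian.2 (inferInstance :
      IsNoetherian (PS n K) (PS n K)) s
    have h1 : ((g ^ (N + 1))⁻¹ : Aut n K) y ∈ s (N + 1) := by
      change (g ^ (N + 1) * (g ^ (N + 1))⁻¹ : Aut n K) y ∈ J
      rw [mul_inv_cancel]
      exact hy
    rw [← hN (N + 1) (Nat.le_succ N)] at h1
    have h2 : (g⁻¹ : Aut n K) y ∈ J := by
      have : (g ^ N * (g ^ (N + 1))⁻¹ : Aut n K) = g⁻¹ := by group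
      rw [← this]
      exact h1
    have h3 := Ideal.mem_map_of_mem (g : PS n K →+* PS n K) h2
    have h4 : (g : PS n K →+* PS n K) ((g⁻¹ : Aut n K) y) = y := by
      change (g * g⁻¹ : Aut n K) y = y
      rw [mul_inv_cancel]
      rfl
    rwa [h4] at h3

theorem fixes_inv_mem {g : Aut n K} {J : Ideal (PS n K)} (h : Fixes g J) {f : PS n K}
    (hf : f ∈ J) : (g⁻¹ : Aut n K) f ∈ J := by
  have : g⁻¹ ∈ G (fun _ : Unit => J) := inv_mem (show g ∈ G (fun _ : Unit => J) from fun _ => h)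
  exact Fixes.map_mem (this ()) hf

theorem mem_maximalIdeal {f : PS n K} :
    f ∈ IsLocalRing.maximalIdeal (PS n K) ↔ constantCoeff f = 0 := by
  rw [IsLocalRing.mem_maximalIdeal, mem_nonunits_iff, isUnit_iff_constantCoeff, isUnit_iff_ne_zero,
    not_not]

/-- If the constant term `c` of the image were nonzero, `x_i - c` would be a unit whose image has
constant term zero. -/
theorem constantCoeff_algHom_X (φ : PS n K →ₐ[K] PS n K) (i : Fin n) :
    constantCoeff (φ (X i)) = 0 := by
  by_contra h
  set c := constantCoeff (φ (X i)) with hc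
  have hu : IsUnit (X i - algebraMap K (PS n K) c) := by
    rw [isUnit_iff_constantCoeff, map_sub, constantCoeff_X, zero_sub]
    simpa [MvPowerSeries.algebraMap_apply] using h
  have := hu.map φ
  rw [isUnit_iff_constantCoeff, map_sub, map_sub, AlgHom.commutes, ← hc] at this
  simp [MvPowerSeries.algebraMap_apply] at this

end Basics

/-! ### Weight filtrations and unipotent automorphisms -/

section Filtration

variable {n : ℕ} {K : Type*} [Field K]

/-- The ideal of power series all of whose monomials have weight at least `d`. -/
noncomputable def wfilt (K : Type*) [Field K] (w : Fin n → ℕ) (d : ℕ) : Ideal (PS n K) :=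
  supportedIdeal {v | d ≤ Finsupp.weight w v} (fun a b hab ha =>
    le_trans (show d ≤ Finsupp.weight w a from ha) (by
      rw [← tsub_add_cancel_of_le hab, map_add]
      exact Nat.le_add_left _ _))

variable {w : Fin n → ℕ}

theorem coeff_eq_zero_of_mem_wfilt {d : ℕ} {f : PS n K} (hf : f ∈ wfilt K w d)
    {v : Fin n →₀ ℕ} (hv : Finsupp.weight w v < d) : coeff v f = 0 := by
  by_contra h
  exact absurd (hf v h) (not_le.2 hv)

theorem isMonomial_wfilt (d : ℕ) : IsMonomial (wfilt K w d) := isMonomial_supportedIdeal _ _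

theorem mono_mem_wfilt {d : ℕ} {v : Fin n →₀ ℕ} :
    mono K v ∈ wfilt K w d ↔ d ≤ Finsupp.weight w v := mono_mem_supportedIdeal

theorem wfilt_anti {d e : ℕ} (h : d ≤ e) : wfilt K w e ≤ wfilt K w d :=
  fun _ hf v hv => h.trans (hf v hv)

theorem wfilt_zero : wfilt K w 0 = ⊤ := by
  rw [Ideal.eq_top_iff_one, ← mono_zero, mono_mem_wfilt]
  exact Nat.zero_le _

theorem mul_mem_wfilt {d e : ℕ} {f g : PS n K} (hf : f ∈ wfilt K w d) (hg : g ∈ wfilt K w e) :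
    f * g ∈ wfilt K w (d + e) := by
  classical
  intro v hv
  rw [coeff_mul] at hv
  obtain ⟨p, hp, hne⟩ := Finset.exists_ne_zero_of_sum_ne_zero hv
  rw [Finset.HasAntidiagonal.mem_antidiagonal] at hp
  change d + e ≤ Finsupp.weight w v
  rw [← hp, map_add]
  exact add_le_add (hf _ (left_ne_zero_of_mul hne)) (hg _ (right_ne_zero_of_mul hne))

theorem eq_zero_of_forall_mem_wfilt {f : PS n K} (h : ∀ d, f ∈ wfilt K w d) : f = 0 := by
  ext v
  exact coeff_eq_zero_of_mem_wfilt (h (Finsupp.weight w v + 1)) (Nat.lt_succ_self _)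

theorem weight_single_one (i : Fin n) : Finsupp.weight w (Finsupp.single i 1) = w i := by
  simp [Finsupp.weight_single]

theorem X_mem_wfilt (i : Fin n) : (X i : PS n K) ∈ wfilt K w (w i) := by
  rw [← mono_single, mono_mem_wfilt, weight_single_one]

theorem weight_pos (hw : ∀ i, 0 < w i) {v : Fin n →₀ ℕ} (hv : v ≠ 0) :
    0 < Finsupp.weight w v := by
  obtain ⟨i, hi⟩ := Finsupp.ne_iff.1 hv
  have : Finsupp.single i 1 ≤ v := by
    rw [Finsupp.single_le_iff]
    exact Nat.one_le_iff_ne_zero.2 hi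
  rw [← tsub_add_cancel_of_le this, map_add, weight_single_one]
  exact Nat.add_pos_right _ (hw i)

theorem mem_wfilt_one (hw : ∀ i, 0 < w i) {f : PS n K} :
    f ∈ wfilt K w 1 ↔ constantCoeff f = 0 := by
  constructor
  · intro h
    rw [← coeff_zero_eq_constantCoeff_apply]
    exact coeff_eq_zero_of_mem_wfilt h (by simp)
  · intro h v hv
    refine weight_pos hw ?_
    rintro rfl
    exact hv (by simpa using h)

/-- Induction on monomials. -/
theorem mono_induction {p : (Fin n →₀ ℕ) → Prop} (h0 : p 0)
    (h1 : ∀ i v, p v → p (Finsupp.single i 1 + v)) (v : Fin n →₀ ℕ) : p v := by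
  induction v using Finsupp.induction with
  | zero => exact h0
  | single_add i b f _ _ ih =>
    clear * - ih h1
    induction b with
    | zero => simpa using ih
    | succ b ihb =>
      rw [add_comm b 1, Finsupp.single_add, add_assoc]
      exact h1 _ _ ihb

theorem algHom_mem_wfilt (φ : PS n K →ₐ[K] PS n K) (hφ : ∀ i, φ (X i) ∈ wfilt K w (w i))
    {d : ℕ} {f : PS n K} (hf : f ∈ wfilt K w d) : φ f ∈ wfilt K w d := by
  refine (isMonomial_wfilt d).map_mem (φ : PS n K →+* PS n K) (fun v hv => ?_) hf
  rw [mono_mem_wfilt] at hv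
  refine wfilt_anti hv ?_
  clear hv hf
  induction v using mono_induction with
  | h0 => rw [map_zero, wfilt_zero]; trivial
  | h1 i v ih =>
    rw [mono_add, map_mul, map_add, weight_single_one, mono_single]
    exact mul_mem_wfilt (hφ i) ih

theorem algHom_sub_mem_wfilt (hw : ∀ i, 0 < w i) (φ : PS n K →ₐ[K] PS n K)
    (hφ : ∀ i, φ (X i) - X i ∈ wfilt K w (w i + 1))
    {d : ℕ} {f : PS n K} (hf : f ∈ wfilt K w d) : φ f - f ∈ wfilt K w (d + 1) := by
  have hX : ∀ i, φ (X i) ∈ wfilt K w (w i) := fun i => by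
    rw [← sub_add_cancel (φ (X i)) (X i)]
    exact add_mem (wfilt_anti (Nat.le_succ _) (hφ i)) (X_mem_wfilt i)
  -- Needed for the coefficients of an ideal combination: `φ` fixes the constant term of `r` and
  -- keeps the rest in weight at least 1.
  have h1 : ∀ r : PS n K, φ r - r ∈ wfilt K w 1 := fun r => by
    have hr : r - algebraMap K (PS n K) (constantCoeff r) ∈ wfilt K w 1 := by
      rw [mem_wfilt_one hw]
      simp [MvPowerSeries.algebraMap_apply]
    have := sub_mem (algHom_mem_wfilt φ hX hr) hr
    rwa [map_sub, AlgHom.commutes, sub_sub_sub_cancel_right] at this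
  have hm : ∀ v, φ (mono K v) - mono K v ∈ wfilt K w (Finsupp.weight w v + 1) := fun v => by
    induction v using mono_induction with
    | h0 => rw [mono_zero, map_one, sub_self]; exact zero_mem _
    | h1 i v ih =>
      rw [mono_add, map_mul, map_add, weight_single_one, mono_single]
      have e : φ (X i) * φ (mono K v) - X i * mono K v =
        φ (X i) * (φ (mono K v) - mono K v) + (φ (X i) - X i) * mono K v := by ring
      rw [e]
      refine add_mem ?_ ?_
      · rw [add_assoc]
        exact mul_mem_wfilt (hX i) ih
      · rw [add_right_comm]
        exact mul_mem_wfilt (hφ i) (mono_mem_wfilt.2 le_rfl)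
  rw [(isMonomial_wfilt d).eq_span] at hf
  induction hf using Submodule.span_induction with
  | mem x hx =>
    obtain ⟨v, hv, rfl⟩ := hx
    exact wfilt_anti (Nat.succ_le_succ (mono_mem_wfilt.1 hv)) (hm v)
  | zero => rw [map_zero, sub_zero]; exact zero_mem _
  | add x y _ _ hx hy =>
    rw [map_add, add_sub_add_comm]
    exact add_mem hx hy
  | smul a x hx ih =>
    rw [smul_eq_mul, map_mul]
    have e : φ a * φ x - a * x = (φ a - a) * x + φ a * (φ x - x) := by ring
    rw [e]
    refine add_mem ?_ (Ideal.mul_mem_left _ _ ih)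
    rw [add_comm d 1]
    refine mul_mem_wfilt (h1 a) ?_
    rw [(isMonomial_wfilt d).eq_span]
    exact hx

/-- A kernel element has arbitrarily large weight, hence vanishes. A preimage of `b` is the limit of
the iteration `s ↦ s + (b - φ s)`, whose error gains weight at each step. -/
theorem unipotent_bijective (hw : ∀ i, 0 < w i) (φ : PS n K →ₐ[K] PS n K)
    (hφ : ∀ i, φ (X i) - X i ∈ wfilt K w (w i + 1)) : Function.Bijective φ := by
  have hraise : ∀ {d : ℕ} {f : PS n K}, f ∈ wfilt K w d → φ f - f ∈ wfilt K w (d + 1) :=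
    algHom_sub_mem_wfilt hw φ hφ
  constructor
  · rw [injective_iff_map_eq_zero]
    intro f hf
    refine eq_zero_of_forall_mem_wfilt (w := w) fun d => ?_
    induction d with
    | zero => rw [wfilt_zero]; trivial
    | succ d ih =>
      have := hraise ih
      rw [hf, zero_sub] at this
      simpa using this
  · intro b
    let s : ℕ → PS n K := fun k => Nat.rec 0 (fun _ a => a + (b - φ a)) k
    have hs : ∀ k, s (k + 1) = s k + (b - φ (s k)) := fun k => rfl
    have hr : ∀ k, b - φ (s k) ∈ wfilt K w k := fun k => by
      induction k with
      | zero => rw [wfilt_zero]; trivial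
      | succ k ih =>
        rw [hs, map_add, ← sub_sub, ← neg_sub (φ _)]
        exact neg_mem (hraise ih)
    have hdiff : ∀ k j, k ≤ j → s j - s k ∈ wfilt K w k := fun k j hkj => by
      induction j, hkj using Nat.le_induction with
      | base => rw [sub_self]; exact zero_mem _
      | succ j hj ih =>
        rw [hs, add_sub_right_comm]
        exact add_mem ih (wfilt_anti hj (hr j))
    -- Coefficients of weight `d` no longer change from step `d + 1` on.
    let a : PS n K := fun v => coeff v (s (Finsupp.weight w v + 1))
    have ha : ∀ k, a - s k ∈ wfilt K w k := fun k v hv => by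
      change k ≤ Finsupp.weight w v
      by_contra! hlt
      apply hv
      have e := coeff_eq_zero_of_mem_wfilt (hdiff _ _ (Nat.succ_le_of_lt hlt)) (Nat.lt_succ_self _)
      rw [map_sub] at e ⊢
      rw [← neg_eq_zero, neg_sub]
      exact e
    have hX : ∀ i, φ (X i) ∈ wfilt K w (w i) := fun i => by
      rw [← sub_add_cancel (φ (X i)) (X i)]
      exact add_mem (wfilt_anti (Nat.le_succ _) (hφ i)) (X_mem_wfilt i)
    refine ⟨a, sub_eq_zero.1 (eq_zero_of_forall_mem_wfilt (w := w) fun k => ?_)⟩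
    have e : φ a - b = φ (a - s k) - (b - φ (s k)) := by rw [map_sub]; ring
    rw [e]
    exact sub_mem (algHom_mem_wfilt φ hX (ha k)) (hr k)

theorem exists_aut_of_unipotent (hw : ∀ i, 0 < w i) (F : Fin n → PS n K)
    (hF : ∀ i, F i - X i ∈ wfilt K w (w i + 1)) : ∃ g : Aut n K, ∀ i, g (X i) = F i := by
  have h0 : ∀ i, constantCoeff (F i) = 0 := fun i => by
    have : F i ∈ wfilt K w 1 := by
      rw [← sub_add_cancel (F i) (X i)]
      exact add_mem (wfilt_anti (Nat.succ_le_succ (Nat.zero_le _)) (hF i))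
        (wfilt_anti (hw i) (X_mem_wfilt i))
    exact (mem_wfilt_one hw).1 this
  have hs : HasSubst F := hasSubst_of_constantCoeff_zero h0
  have hX : ∀ i, substAlgHom (R := K) hs (X i) = F i := fun i => substAlgHom_X hs i
  exact ⟨AlgEquiv.ofBijective (substAlgHom (R := K) hs)
    (unipotent_bijective hw _ fun i => by rw [hX]; exact hF i), hX⟩

theorem exists_aut_smul (c : Fin n → K) (hc : ∀ i, c i ≠ 0) :
    ∃ g : Aut n K, ∀ i, g (X i) = c i • X i := by
  have h : ∀ a b : Fin n → K, a * b = 1 →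
      (rescaleAlgHom a).comp (rescaleAlgHom b) = AlgHom.id K (PS n K) := fun a b hab => by
    rw [← rescaleAlgHom_mul, mul_comm, hab, rescaleAlgHom_one]
  refine ⟨AlgEquiv.ofAlgHom (rescaleAlgHom c) (rescaleAlgHom c⁻¹)
    (h _ _ (funext fun i => mul_inv_cancel₀ (hc i)))
    (h _ _ (funext fun i => inv_mul_cancel₀ (hc i))), fun i => ?_⟩
  classical
  ext v
  change coeff v (rescaleAlgHom c (X i)) = _
  rw [rescaleAlgHom_apply, coeff_rescale, coeff_smul, coeff_X]
  split_ifs with h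
  · subst h
    simp
  · simp

theorem algHom_X_mem_wfilt (φ : PS n K →ₐ[K] PS n K) (i : Fin n) :
    φ (X i) ∈ wfilt K (fun _ : Fin n => 1) 1 :=
  (mem_wfilt_one fun _ => Nat.one_pos).2 (constantCoeff_algHom_X φ i)

/-- Continuity of algebra endomorphisms: they agree on a power series as soon as they agree on its
monomials. -/
theorem algHom_congr {φ ψ : PS n K →ₐ[K] PS n K} {f : PS n K}
    (h : ∀ v, coeff v f ≠ 0 → φ (mono K v) = ψ (mono K v)) : φ f = ψ f := by
  refine sub_eq_zero.1 (eq_zero_of_forall_mem_wfilt (w := fun _ => 1) fun d => ?_)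
  have hcoeff : ∀ v, (truncTotal d f).coeff v = if v.degree < d then coeff v f else 0 :=
    fun v => coeff_truncTotal_eq_ite _
  obtain ⟨p, hp⟩ : ∃ p, p = truncTotal d f := ⟨_, rfl⟩
  rw [← hp] at hcoeff
  have hpf : f - p ∈ wfilt K (fun _ : Fin n => 1) d := fun v hv => by
    change d ≤ Finsupp.weight (fun _ => 1) v
    by_contra! hlt
    apply hv
    rw [map_sub, MvPolynomial.coeff_coe, hcoeff, if_pos (by
      rw [Finsupp.degree_eq_weight_one]; exact hlt), sub_self]
  have hpol : φ (p : PS n K) = ψ (p : PS n K) := by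
    have e : (p : PS n K) = ∑ v ∈ p.support, p.coeff v • mono K v := by
      conv_lhs => rw [← MvPolynomial.support_sum_monomial_coeff p]
      rw [← MvPolynomial.coeToMvPowerSeries.ringHom_apply, map_sum]
      refine Finset.sum_congr rfl fun v _ => ?_
      simp [mono, ← map_smul]
    rw [e, map_sum, map_sum]
    refine Finset.sum_congr rfl fun v hv => ?_
    rw [map_smul, map_smul, h]
    rw [MvPolynomial.mem_support_iff, hcoeff] at hv
    exact fun h0 => hv (by rw [h0, ite_self])
  have e : φ f - ψ f = φ (f - p) - ψ (f - p) := by rw [map_sub, map_sub, hpol]; ring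
  rw [e]
  exact sub_mem (algHom_mem_wfilt φ (algHom_X_mem_wfilt φ) hpf)
    (algHom_mem_wfilt ψ (algHom_X_mem_wfilt ψ) hpf)

theorem algHom_ext {φ ψ : PS n K →ₐ[K] PS n K} (h : ∀ i, φ (X i) = ψ (X i)) : φ = ψ := by
  ext1 f
  refine algHom_congr fun v hv => ?_
  clear hv
  induction v using mono_induction with
  | h0 => rw [mono_zero, map_one, map_one]
  | h1 i v ih => rw [mono_add, map_mul, map_mul, mono_single, h, ih]

theorem aut_ext {g h : Aut n K} (H : ∀ i, g (X i) = h (X i)) : g = h := by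
  have := algHom_ext (φ := (g : PS n K →ₐ[K] PS n K)) (ψ := (h : PS n K →ₐ[K] PS n K)) H
  ext1 f
  exact DFunLike.congr_fun this f

end Filtration

/-! ### Transvections preserving a monomial ideal -/

section Transvections

variable {n : ℕ} {K : Type*} [Field K]

/-- No monomial of `h` involves `x_i`. -/
def IsFree (i : Fin n) (h : PS n K) : Prop := ∀ v, v i ≠ 0 → coeff v h = 0

theorem isFree_one (i : Fin n) : IsFree i (1 : PS n K) := fun v hv => by
  rw [coeff_one, if_neg]
  rintro rfl
  exact hv rfl

theorem IsFree.mul {i : Fin n} {f g : PS n K} (hf : IsFree i f) (hg : IsFree i g) :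
    IsFree i (f * g) := fun v hv => by
  rw [coeff_mul]
  refine Finset.sum_eq_zero fun p hp => ?_
  rw [Finset.HasAntidiagonal.mem_antidiagonal] at hp
  by_cases h : p.1 i = 0
  · rw [hg p.2, mul_zero]
    rw [← hp] at hv
    simpa [h] using hv
  · rw [hf p.1 h, zero_mul]

theorem IsFree.pow {i : Fin n} {f : PS n K} (hf : IsFree i f) (k : ℕ) : IsFree i (f ^ k) := by
  induction k with
  | zero => rw [pow_zero]; exact isFree_one i
  | succ k ih => rw [pow_succ]; exact ih.mul hf

theorem map_mono_of_free {φ : PS n K →ₐ[K] PS n K} {i : Fin n} (hφ : ∀ j, j ≠ i → φ (X j) = X j)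
    {v : Fin n →₀ ℕ} (hv : v i = 0) : φ (mono K v) = mono K v := by
  induction v using mono_induction with
  | h0 => rw [mono_zero, map_one]
  | h1 j v ih =>
    rw [Finsupp.add_apply, Nat.add_eq_zero_iff] at hv
    have hji : j ≠ i := by
      rintro rfl
      simp at hv
    rw [mono_add, map_mul, ih hv.2, mono_single, hφ j hji]

theorem map_of_free {φ : PS n K →ₐ[K] PS n K} {i : Fin n} (hφ : ∀ j, j ≠ i → φ (X j) = X j)
    {h : PS n K} (hh : IsFree i h) : φ h = h := by
  refine algHom_congr (φ := φ) (ψ := AlgHom.id K _) fun v hv => ?_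
  refine map_mono_of_free hφ ?_
  by_contra h0
  exact hv (hh v h0)

theorem aut_map_of_free {g : Aut n K} {i : Fin n} (hg : ∀ j, j ≠ i → g (X j) = X j)
    {h : PS n K} (hh : IsFree i h) : g h = h :=
  map_of_free (φ := (g : PS n K →ₐ[K] PS n K)) hg hh

theorem isFree_smul_mono {i : Fin n} {v : Fin n →₀ ℕ} (hv : v i = 0) (c : K) :
    IsFree i (c • mono K v) := fun u hu => by
  rw [coeff_smul, coeff_mono, if_neg, mul_zero]
  rintro rfl
  exact hu hv

/-- The automorphism `g` adds `h` to `x_i` and fixes the other variables. -/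
def IsTransvection (g : Aut n K) (i : Fin n) (h : PS n K) : Prop :=
  g (X i) = X i + h ∧ ∀ j, j ≠ i → g (X j) = X j

theorem exists_isTransvection (i : Fin n) {h : PS n K} (h0 : constantCoeff h = 0)
    (hh : IsFree i h) : ∃ g : Aut n K, IsTransvection g i h := by
  classical
  -- With these weights every series free of `x_i` and without constant term is heavier than `x_i`,
  -- even if it has linear terms.
  let w : Fin n → ℕ := fun j => if j = i then 1 else 2
  obtain ⟨g, hg⟩ := exists_aut_of_unipotent (K := K) (w := w)
    (fun j => by simp only [w]; split_ifs <;> norm_num)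
    (fun j => if j = i then X i + h else X j) (fun j => by
      by_cases hj : j = i
      · subst hj
        simp only [if_true, add_sub_cancel_left, w]
        intro v hv
        change 2 ≤ Finsupp.weight w v
        have hvj : v j = 0 := by
          by_contra hne
          exact hv (hh v hne)
        have hv0 : v ≠ 0 := by
          rintro rfl
          exact hv (by simpa using h0)
        obtain ⟨l, hl⟩ := Finsupp.ne_iff.1 hv0
        have hle : Finsupp.single l 1 ≤ v := by
          rw [Finsupp.single_le_iff]
          exact Nat.one_le_iff_ne_zero.2 hl
        have hlj : l ≠ j := by
          rintro rfl
          exact hl hvj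
        rw [← tsub_add_cancel_of_le hle, map_add, weight_single_one]
        simp only [w, if_neg hlj]
        exact Nat.le_add_left _ _
      · simp only [if_neg hj, sub_self]
        exact zero_mem _)
  refine ⟨g, by simp [hg], fun j hj => by simp [hg, hj]⟩

theorem exists_isTransvection_mono (i : Fin n) {v : Fin n →₀ ℕ} (hv0 : v ≠ 0) (hv : v i = 0)
    (c : K) : ∃ g : Aut n K, IsTransvection g i (c • mono K v) := by
  refine exists_isTransvection i ?_ (isFree_smul_mono hv c)
  rw [← coeff_zero_eq_constantCoeff_apply, coeff_smul, coeff_mono, if_neg (Ne.symm hv0), mul_zero]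

theorem mono_eq_pow_mul_erase (i : Fin n) (v : Fin n →₀ ℕ) :
    mono K v = X i ^ v i * mono K (v.erase i) := by
  conv_lhs => rw [← Finsupp.single_add_erase i v]
  rw [mono_add, ← mono_single, ← mono_nsmul, Finsupp.smul_single, smul_eq_mul, mul_one]

theorem IsTransvection.map_mono {g : Aut n K} {i : Fin n} {h : PS n K} (hg : IsTransvection g i h)
    (a : Fin n →₀ ℕ) : g (mono K a) = ∑ k ∈ Finset.range (a i + 1),
      ((a i).choose k : K) • (h ^ k * mono K (a - Finsupp.single i k)) := by
  rw [mono_eq_pow_mul_erase i a, map_mul, map_pow, hg.1, aut_map_of_free hg.2 (h := mono K (a.erase i))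
    (by simpa using isFree_smul_mono (i := i) (v := a.erase i) (by simp) (1 : K)), add_comm, add_pow,
    Finset.sum_mul]
  refine Finset.sum_congr rfl fun k hk => ?_
  have e : mono K (a - Finsupp.single i k) = X i ^ (a i - k) * mono K (a.erase i) := by
    rw [mono_eq_pow_mul_erase i]
    congr 2
    · simp
    · ext j
      by_cases hj : j = i
      · simp [hj]
      · simp [hj]
  rw [e, Nat.cast_smul_eq_nsmul, nsmul_eq_mul]
  ring

/-- The condition on the exponent `v`, free of `x_i`, under which `x_i ↦ x_i + c x^v` maps the
ideal `J` into itself. -/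
def Admissible (J : Ideal (PS n K)) (i : Fin n) (v : Fin n →₀ ℕ) : Prop :=
  ∀ (a : Fin n →₀ ℕ) (k : ℕ), mono K a ∈ J → ((a i).choose k : K) ≠ 0 →
    mono K (a - Finsupp.single i k + k • v) ∈ J

theorem Admissible.mono_le {J : Ideal (PS n K)} {i : Fin n} {u v : Fin n →₀ ℕ}
    (h : Admissible J i u) (huv : u ≤ v) : Admissible J i v := fun a k ha hk =>
  mono_mem_of_le (add_le_add le_rfl (nsmul_le_nsmul_right huv k)) (h a k ha hk)

theorem admissible_of_mono_mem {J : Ideal (PS n K)} {i : Fin n} {v : Fin n →₀ ℕ}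
    (h : mono K v ∈ J) : Admissible J i v := fun a k ha _ => by
  rcases Nat.eq_zero_or_pos k with rfl | hk
  · simpa using ha
  · refine mono_mem_of_le (le_add_left ?_) h
    calc v = 1 • v := (one_nsmul v).symm
      _ ≤ k • v := nsmul_le_nsmul_left zero_le hk

theorem IsTransvection.fixes {J : Ideal (PS n K)} (hJ : IsMonomial J) {g : Aut n K} {i : Fin n}
    {v : Fin n →₀ ℕ} {c : K} (hg : IsTransvection g i (c • mono K v)) (hv : Admissible J i v) :
    Fixes g J := by
  refine fixes_of_map_mem fun f hf => hJ.map_mem (g : PS n K →+* PS n K) (fun a ha => ?_) hf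
  change g (mono K a) ∈ J
  rw [hg.map_mono]
  refine Submodule.sum_mem _ fun k _ => ?_
  by_cases hk : ((a i).choose k : K) = 0
  · rw [hk, zero_smul]
    exact zero_mem _
  · have e : (c • mono K v) ^ k * mono K (a - Finsupp.single i k) =
        c ^ k • mono K (a - Finsupp.single i k + k • v) := by
      rw [smul_pow, smul_mul_assoc, ← mono_nsmul, ← mono_add, add_comm]
    rw [e]
    exact Submodule.smul_of_tower_mem _ _ (Submodule.smul_of_tower_mem _ _ (hv a k ha hk))

theorem lexOrder_pow {h : PS n K} {v : Fin n →₀ ℕ} (hv : lexOrder h = toLex v) (k : ℕ) :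
    lexOrder (h ^ k) = toLex (k • v) := by
  induction k with
  | zero =>
    rw [pow_zero, zero_smul]
    apply le_antisymm
    · exact lexOrder_le_of_coeff_ne_zero (by simp)
    · rw [le_lexOrder_iff]
      intro d hd
      have : toLex d < toLex 0 := WithTop.coe_lt_coe.1 hd
      exact absurd this (not_lt.2 (Finsupp.toLex_monotone zero_le))
  | succ k ih =>
    rw [pow_succ, lexOrder_mul, ih, hv, succ_nsmul]
    rfl

/-- In the binomial expansion of `g (x^a)` the summands have distinct degrees in `x_i`, so they
cannot cancel. Within the `k`-th one, the lexicographically leading term of `h ^ k` has exponent `k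
• v`, because leading terms multiply. -/
theorem IsTransvection.admissible {J : Ideal (PS n K)} (hJ : IsMonomial J) {g : Aut n K}
    {i : Fin n} {h : PS n K} (hg : IsTransvection g i h) (hh : IsFree i h) (hgJ : Fixes g J)
    {v : Fin n →₀ ℕ} (hv : lexOrder h = toLex v) : Admissible J i v := by
  intro a k ha hk
  have hka : k ≤ a i := by
    by_contra! hlt
    exact hk (by rw [Nat.choose_eq_zero_of_lt hlt, Nat.cast_zero])
  have hvi : v i = 0 := by
    by_contra hne
    exact coeff_ne_zero_of_lexOrder hv.symm (hh v hne)
  refine hJ.mem_iff.1 (hgJ.map_mem ha) _ ?_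
  rw [hg.map_mono, map_sum, Finset.sum_eq_single k]
  · rw [coeff_smul, mono, coeff_mul_monomial, if_pos (le_add_right le_rfl), add_tsub_cancel_left,
      mul_one]
    exact mul_ne_zero hk (coeff_ne_zero_of_lexOrder (lexOrder_pow hv k).symm)
  · intro l hl hlk
    rw [coeff_smul, mono, coeff_mul_monomial]
    split_ifs with hle
    · have h1 := hle i
      simp [hvi] at h1
      rw [hh.pow l, zero_mul, mul_zero]
      rw [Finset.mem_range] at hl
      simp [hvi]
      omega
    · rw [mul_zero]
  · intro hk'
    exact absurd (Finset.mem_range.2 (Nat.lt_succ_of_le hka)) hk'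

theorem IsTransvection.mul {g t : Aut n K} {i : Fin n} {h r : PS n K} (hg : IsTransvection g i h)
    (ht : IsTransvection t i r) (hr : IsFree i r) : IsTransvection (g * t) i (h + r) := by
  refine ⟨?_, fun j hj => ?_⟩
  · change g (t (X i)) = _
    rw [ht.1, map_add, hg.1, aut_map_of_free hg.2 hr, add_assoc]
  · change g (t (X j)) = _
    rw [ht.2 j hj, hg.2 j hj]

theorem IsTransvection.constantCoeff {g : Aut n K} {i : Fin n} {h : PS n K}
    (hg : IsTransvection g i h) : constantCoeff h = 0 := by
  have := constantCoeff_algHom_X (g : PS n K →ₐ[K] PS n K) i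
  change MvPowerSeries.constantCoeff (g (X i)) = 0 at this
  rwa [hg.1, map_add, constantCoeff_X, zero_add] at this

/-- The leading exponent of `h` is admissible, so the transvection removing that term preserves the
ideals; composing with it shrinks the support. -/
theorem admissible_of_finite_support {ι : Type*} {I : ι → Ideal (PS n K)}
    (hI : ∀ k, IsMonomial (I k)) {i : Fin n} (S : Finset (Fin n →₀ ℕ)) :
    ∀ (h : PS n K) (g : Aut n K), IsFree i h → (∀ v, coeff v h ≠ 0 → v ∈ S) →
      IsTransvection g i h → g ∈ G I → ∀ v, coeff v h ≠ 0 → ∀ k, Admissible (I k) i v := by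
  classical
  induction S using Finset.strongInduction with
  | H S ih =>
    intro h g hh hS hg hgI u hu
    have hne : h ≠ 0 := by
      rintro rfl
      exact hu (coeff_zero _)
    obtain ⟨v, hv⟩ := exists_finsupp_eq_lexOrder_of_ne_zero hne
    have hvc := coeff_ne_zero_of_lexOrder hv.symm
    have hvA : ∀ k, Admissible (I k) i v := fun k => hg.admissible (hI k) hh (hgI k) hv
    by_cases huv : u = v
    · exact huv ▸ hvA
    have hvi : v i = 0 := by
      by_contra h0
      exact hvc (hh v h0)
    have hv0 : v ≠ 0 := by
      rintro rfl
      exact hvc (by simpa using hg.constantCoeff)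
    obtain ⟨t, ht⟩ := exists_isTransvection_mono i hv0 hvi (-coeff v h)
    have htI : t ∈ G I := fun k => ht.fixes (hI k) (hvA k)
    have hcoeff : ∀ x, coeff x (h + (-coeff v h) • mono K v) = if x = v then 0 else coeff x h :=
      fun x => by
        rw [map_add, coeff_smul, coeff_mono]
        split_ifs with hx
        · rw [hx]; ring
        · ring
    refine ih (S.erase v) (Finset.erase_ssubset (hS v hvc)) _ (g * t) ?_ ?_
      (hg.mul ht (isFree_smul_mono hvi _)) (mul_mem hgI htI) u ?_
    · intro x hx
      rw [hcoeff, hh x hx, ite_self]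
    · intro x hx
      rw [hcoeff] at hx
      split_ifs at hx with hxv
      · exact absurd rfl hx
      · exact Finset.mem_erase.2 ⟨hxv, hS x hx⟩
    · rw [hcoeff, if_neg huv]
      exact hu

/-- Automorphisms congruent to the identity modulo a monomial ideal fix it. -/
theorem fixes_of_sub_mem {J : Ideal (PS n K)} (hJ : IsMonomial J) {g : Aut n K}
    (h : ∀ i, g (X i) - X i ∈ J) : Fixes g J := by
  have hm : ∀ v, g (mono K v) - mono K v ∈ J := fun v => by
    induction v using mono_induction with
    | h0 => rw [mono_zero, map_one, sub_self]; exact zero_mem _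
    | h1 i v ih =>
      rw [mono_add, map_mul, mono_single]
      have e : g (X i) * g (mono K v) - X i * mono K v =
        g (X i) * (g (mono K v) - mono K v) + (g (X i) - X i) * mono K v := by ring
      rw [e]
      exact add_mem (J.mul_mem_left _ ih) (J.mul_mem_right _ (h i))
  refine fixes_of_map_mem fun f hf => hJ.map_mem (g : PS n K →+* PS n K) (fun a ha => ?_) hf
  change g (mono K a) ∈ J
  rw [← sub_add_cancel (g (mono K a)) (mono K a)]
  exact add_mem (hm a) ha

theorem fixes_of_dvd {J : Ideal (PS n K)} (hJ : IsMonomial J) {g : Aut n K}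
    (h : ∀ i, (X i : PS n K) ∣ g (X i)) : Fixes g J := by
  have hm : ∀ v, mono K v ∣ g (mono K v) := fun v => by
    induction v using mono_induction with
    | h0 => rw [mono_zero]; exact one_dvd _
    | h1 i v ih =>
      rw [mono_add, map_mul, mono_single]
      exact mul_dvd_mul (h i) ih
  exact fixes_of_map_mem fun f hf =>
    hJ.map_mem (g : PS n K →+* PS n K) (fun a ha => J.mem_of_dvd (hm a) ha) hf

/-- All monomials of degree at least `N` lie in `J`. -/
def ContainsDegree (J : Ideal (PS n K)) (N : ℕ) : Prop :=
  ∀ v : Fin n →₀ ℕ, N ≤ v.degree → mono K v ∈ J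

/-- The terms of `h` of degree at least `N` lie in every `I k`, so they can be removed by a
transvection congruent to the identity; a polynomial is left. -/
theorem IsTransvection.admissible_of_mem {ι : Type*} {I : ι → Ideal (PS n K)}
    (hI : ∀ k, IsMonomial (I k)) {N : ℕ} (hN : ∀ k, ContainsDegree (I k) N) {i : Fin n}
    {h : PS n K} {g : Aut n K} (hh : IsFree i h) (hg : IsTransvection g i h) (hgI : g ∈ G I)
    {v : Fin n →₀ ℕ} (hv : coeff v h ≠ 0) (k : ι) : Admissible (I k) i v := by
  by_cases hvN : N ≤ v.degree
  · exact admissible_of_mono_mem (hN k v hvN)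
  let p : MvPolynomial (Fin n) K := truncTotal N h
  have hp : ∀ u, coeff u (p : PS n K) = if u.degree < N then coeff u h else 0 := fun u => by
    rw [MvPolynomial.coeff_coe]
    exact coeff_truncTotal_eq_ite _
  have hr : ∀ u, coeff u ((p : PS n K) - h) = if u.degree < N then 0 else -coeff u h := fun u => by
    rw [map_sub, hp]
    split_ifs <;> ring
  have hrfree : IsFree i ((p : PS n K) - h) := fun u hu => by
    rw [hr, hh u hu, neg_zero, ite_self]
  have hr0 : MvPowerSeries.constantCoeff ((p : PS n K) - h) = 0 := by
    rw [← coeff_zero_eq_constantCoeff_apply, hr, coeff_zero_eq_constantCoeff_apply,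
      hg.constantCoeff, neg_zero, ite_self]
  obtain ⟨t, ht⟩ := exists_isTransvection i hr0 hrfree
  have htI : t ∈ G I := fun k => fixes_of_sub_mem (hI k) fun j => by
    by_cases hj : j = i
    · rw [hj, ht.1, add_sub_cancel_left, (hI k).mem_iff]
      intro u hu
      rw [hr] at hu
      split_ifs at hu with hlt
      · exact absurd rfl hu
      · exact hN k u (not_lt.1 hlt)
    · rw [ht.2 j hj, sub_self]
      exact zero_mem _
  have hgt := hg.mul ht hrfree
  rw [add_sub_cancel] at hgt
  refine admissible_of_finite_support hI p.support (p : PS n K) (g * t) ?_ ?_ hgt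
    (mul_mem hgI htI) v ?_ k
  · intro u hu
    rw [hp, hh u hu, ite_self]
  · intro u hu
    rwa [MvPolynomial.mem_support_iff, ← MvPolynomial.coeff_coe]
  · rw [hp, if_pos (not_le.1 hvN)]
    exact hv

end Transvections

/-! ### Linear parts and the chain rule -/

section LinearPart

variable {n : ℕ} {K : Type*} [Field K]

/-- The coefficient of `x_j` in `f`. -/
noncomputable def lin (j : Fin n) (f : PS n K) : K := coeff (Finsupp.single j 1) f

theorem lin_add (j : Fin n) (f g : PS n K) : lin j (f + g) = lin j f + lin j g := map_add _ _ _

theorem lin_sub (j : Fin n) (f g : PS n K) : lin j (f - g) = lin j f - lin j g := map_sub _ _ _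

theorem lin_smul (j : Fin n) (c : K) (f : PS n K) : lin j (c • f) = c * lin j f := coeff_smul _ _ _

theorem lin_sum {ι : Type*} (j : Fin n) (s : Finset ι) (f : ι → PS n K) :
    lin j (∑ k ∈ s, f k) = ∑ k ∈ s, lin j (f k) := map_sum _ _ _

theorem lin_X (i j : Fin n) : lin j (X i : PS n K) = if j = i then 1 else 0 := by
  rw [lin, coeff_X]
  simp [Finsupp.single_left_inj]

theorem eq_zero_or_single_or_two_le_degree (v : Fin n →₀ ℕ) :
    v = 0 ∨ (∃ j, v = Finsupp.single j 1) ∨ 2 ≤ v.degree := by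
  by_cases hv : v = 0
  · exact Or.inl hv
  obtain ⟨j, hj⟩ := Finsupp.ne_iff.1 hv
  have hle : Finsupp.single j 1 ≤ v := by
    rw [Finsupp.single_le_iff]
    exact Nat.one_le_iff_ne_zero.2 hj
  have e : v = v - Finsupp.single j 1 + Finsupp.single j 1 := (tsub_add_cancel_of_le hle).symm
  by_cases h0 : v - Finsupp.single j 1 = 0
  · rw [h0, zero_add] at e
    exact Or.inr (Or.inl ⟨j, e⟩)
  · have h1 : (v - Finsupp.single j 1).degree ≠ 0 := fun h => h0 ((Finsupp.degree_eq_zero_iff _).1 h)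
    refine Or.inr (Or.inr ?_)
    rw [e, map_add, Finsupp.degree_single]
    omega

theorem degree_eq_weight (v : Fin n →₀ ℕ) : v.degree = Finsupp.weight (fun _ : Fin n => 1) v := by
  rw [Finsupp.degree_eq_weight_one]

theorem lin_algHom (φ : PS n K →ₐ[K] PS n K) (l : Fin n) (f : PS n K) :
    lin l (φ f) = ∑ j, lin j f * lin l (φ (X j)) := by
  set L : PS n K := algebraMap K (PS n K) (constantCoeff f) + ∑ j, lin j f • X j with hL
  have hr : f - L ∈ wfilt K (fun _ : Fin n => 1) 2 := fun v hv => by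
    change 2 ≤ Finsupp.weight (fun _ => 1) v
    rw [← degree_eq_weight]
    rcases eq_zero_or_single_or_two_le_degree v with rfl | ⟨j, rfl⟩ | h
    · exfalso
      apply hv
      simp [hL, MvPowerSeries.algebraMap_apply]
    · exfalso
      apply hv
      change lin j (f - L) = 0
      rw [lin_sub, hL, lin_add, lin_sum]
      simp only [lin_smul, lin_X]
      simp [lin, MvPowerSeries.algebraMap_apply, coeff_C]
    · exact h
  have h2 := algHom_mem_wfilt φ (algHom_X_mem_wfilt φ) hr
  have h3 : lin l (φ (f - L)) = 0 := coeff_eq_zero_of_mem_wfilt h2 (by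
    rw [weight_single_one]
    norm_num)
  rw [map_sub, lin_sub, sub_eq_zero] at h3
  rw [h3, hL, map_add, AlgHom.commutes, lin_add, map_sum, lin_sum]
  simp only [map_smul, lin_smul]
  simp [lin, MvPowerSeries.algebraMap_apply, coeff_C]

theorem lin_aut (g : Aut n K) (l : Fin n) (f : PS n K) :
    lin l (g f) = ∑ j, lin j f * lin l (g (X j)) :=
  lin_algHom (g : PS n K →ₐ[K] PS n K) l f

theorem constantCoeff_aut_X (g : Aut n K) (i : Fin n) : constantCoeff (g (X i)) = 0 :=
  constantCoeff_algHom_X (g : PS n K →ₐ[K] PS n K) i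

end LinearPart

/-! ### Structure of the measuring sequence -/

section Measuring

variable {n : ℕ} {K : Type*} [Field K]

/-- Otherwise no linear part in the image of `g` would involve `x_i`, contradicting surjectivity. -/
theorem lin_self_ne_zero {g : Aut n K} {i : Fin n} (hg : ∀ j, j ≠ i → g (X j) = X j) :
    lin i (g (X i)) ≠ 0 := by
  intro h0
  have h := lin_aut g i ((g⁻¹ : Aut n K) (X i))
  have e : g ((g⁻¹ : Aut n K) (X i)) = X i := by
    change (g * g⁻¹ : Aut n K) (X i) = X i
    rw [mul_inv_cancel]
    rfl
  rw [e, lin_X, if_pos rfl, Finset.sum_eq_zero] at h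
  · exact one_ne_zero h
  · intro j _
    by_cases hj : j = i
    · rw [hj, h0, mul_zero]
    · rw [hg j hj, lin_X, if_neg (Ne.symm hj), mul_zero]

theorem exists_aut_mul_unit (i : Fin n) {q : PS n K} (hq : constantCoeff q ≠ 0) :
    ∃ s : Aut n K, s (X i) = X i * q ∧ ∀ j, j ≠ i → s (X j) = X j := by
  classical
  obtain ⟨t, ht⟩ := exists_aut_smul (K := K) (fun j : Fin n => if j = i then constantCoeff q else 1)
    (fun j => by split_ifs <;> simp [hq])
  obtain ⟨u, hu⟩ := exists_aut_of_unipotent (K := K) (w := fun _ : Fin n => 1)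
    (fun _ => Nat.one_pos)
    (fun j => if j = i then X i * ((constantCoeff q)⁻¹ • q) else X j) (fun j => by
      split_ifs with hj
      · subst hj
        have e : X j * ((constantCoeff q)⁻¹ • q) - X j =
            X j * ((constantCoeff q)⁻¹ • q - 1) := by ring
        rw [e]
        refine mul_mem_wfilt (X_mem_wfilt (w := fun _ : Fin n => 1) j) ?_
        rw [mem_wfilt_one fun _ => Nat.one_pos, map_sub, map_one]
        have : constantCoeff ((constantCoeff q)⁻¹ • q) = (constantCoeff q)⁻¹ * constantCoeff q := by
          rw [← coeff_zero_eq_constantCoeff_apply, coeff_smul, coeff_zero_eq_constantCoeff_apply]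
        rw [this, inv_mul_cancel₀ hq, sub_self]
      · rw [sub_self]
        exact zero_mem _)
  refine ⟨u * t, ?_, fun j hj => ?_⟩
  · change u (t (X i)) = _
    rw [ht, if_pos rfl, map_smul, hu, if_pos rfl, ← mul_smul_comm, smul_smul, mul_inv_cancel₀ hq,
      one_smul]
  · change u (t (X j)) = _
    rw [ht, if_neg hj, one_smul, hu, if_neg hj]

/-- Write `g x_i = x_i q + h` with `h` free of `x_i`; then `q` is a unit. The map `x_i ↦ x_i q`
preserves all monomial ideals, and dividing it out leaves the transvection by `h`. -/
theorem admissible_of_mem_G {ι : Type*} {I : ι → Ideal (PS n K)} (hI : ∀ k, IsMonomial (I k))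
    {N : ℕ} (hN : ∀ k, ContainsDegree (I k) N) {i : Fin n} {g : Aut n K}
    (hg : ∀ j, j ≠ i → g (X j) = X j) (hgI : g ∈ G I) {v : Fin n →₀ ℕ} (hvi : v i = 0)
    (hv : coeff v (g (X i)) ≠ 0) (k : ι) : Admissible (I k) i v := by
  obtain ⟨f, hf⟩ : ∃ f, f = g (X i) := ⟨_, rfl⟩
  rw [← hf] at hv
  obtain ⟨q, hq⟩ : ∃ q : PS n K, ∀ u, coeff u q = coeff (u + Finsupp.single i 1) f :=
    ⟨fun u => coeff (u + Finsupp.single i 1) f, fun u => rfl⟩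
  obtain ⟨h, hh⟩ : ∃ h : PS n K, ∀ u, coeff u h = if u i = 0 then coeff u f else 0 :=
    ⟨fun u => if u i = 0 then coeff u f else 0, fun u => rfl⟩
  have hfree : IsFree i h := fun u hu => by rw [hh, if_neg hu]
  have hq0 : constantCoeff q ≠ 0 := by
    rw [← coeff_zero_eq_constantCoeff_apply, hq, zero_add, hf]
    exact lin_self_ne_zero hg
  have hfq : f = X i * q + h := by
    ext u
    rw [map_add, hh, mul_comm, ← mono_single, mono, coeff_mul_monomial, mul_one]
    by_cases hu : u i = 0
    · rw [if_pos hu, if_neg, zero_add]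
      intro hle
      have := hle i
      simp [hu] at this
    · have hle : Finsupp.single i 1 ≤ u := by
        rw [Finsupp.single_le_iff]
        exact Nat.one_le_iff_ne_zero.2 hu
      rw [if_neg hu, if_pos hle, hq, tsub_add_cancel_of_le hle, add_zero]
  obtain ⟨s, hsi, hsj⟩ := exists_aut_mul_unit i hq0
  have hsI : s ∈ G I := fun k => fixes_of_dvd (hI k) fun j => by
    by_cases hj : j = i
    · rw [hj, hsi]
      exact dvd_mul_right _ _
    · rw [hsj j hj]
  have hinv : ∀ y, (s⁻¹ : Aut n K) (s y) = y := fun y => by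
    change (s⁻¹ * s : Aut n K) y = y
    rw [inv_mul_cancel]
    rfl
  have ht : IsTransvection (s⁻¹ * g) i h := by
    refine ⟨?_, fun j hj => ?_⟩
    · change (s⁻¹ : Aut n K) (g (X i)) = _
      rw [← hf, hfq, map_add, ← hsi, hinv]
      congr 1
      conv_lhs => rw [← aut_map_of_free hsj hfree]
      exact hinv h
    · change (s⁻¹ : Aut n K) (g (X j)) = _
      rw [hg j hj]
      conv_lhs => rw [← hsj j hj]
      exact hinv _
  refine ht.admissible_of_mem hI hN hfree (mul_mem (inv_mem hsI) hgI) ?_ k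
  rw [hh, if_pos hvi]
  exact hv

/-- The exponents of a set of monomial generators of the ideal `A_i` of the measuring sequence. -/
def measuringExponents {ι : Type*} (I : ι → Ideal (PS n K)) (i : Fin n) : Set (Fin n →₀ ℕ) :=
  {v | v = Finsupp.single i 1 ∨ (v i = 0 ∧ v ≠ 0 ∧ ∀ k, Admissible (I k) i v)}

theorem measuring_eq_span {r : ℕ} {I : Fin r → Ideal (PS n K)} (hI : ∀ k, IsMonomial (I k))
    {N : ℕ} (hN : ∀ k, ContainsDegree (I k) N) (i : Fin n) :
    measuring I i = Ideal.span (mono K '' measuringExponents I i) := by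
  have hX : (X i : PS n K) ∈ measuring I i :=
    Ideal.subset_span ⟨1, fun j _ => rfl, fun k => one_mem (G I) k, rfl⟩
  apply le_antisymm
  · rw [measuring, Ideal.span_le]
    rintro _ ⟨g, hg, hgI, rfl⟩
    refine mem_span_mono.2 fun v hv => ?_
    by_cases hvi : v i = 0
    · refine ⟨v, Or.inr ⟨hvi, ?_, admissible_of_mem_G hI hN hg hgI hvi hv⟩, le_rfl⟩
      rintro rfl
      exact hv (by simpa using constantCoeff_aut_X g i)
    · refine ⟨_, Or.inl rfl, ?_⟩
      rw [Finsupp.single_le_iff]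
      exact Nat.one_le_iff_ne_zero.2 hvi
  · rw [Ideal.span_le]
    rintro _ ⟨v, rfl | ⟨hvi, hv0, hv⟩, rfl⟩
    · exact hX
    · obtain ⟨t, ht⟩ := exists_isTransvection_mono i hv0 hvi (1 : K)
      have h1 : t (X i) ∈ measuring I i :=
        Ideal.subset_span ⟨t, ht.2, fun k => ht.fixes (hI k) (hv k), rfl⟩
      rw [ht.1, one_smul] at h1
      exact (Ideal.add_mem_iff_right _ hX).1 h1

/-- The monomials outside `J` are linearly independent modulo `J`, hence finite in number. -/
theorem exists_containsDegree {J : Ideal (PS n K)} (hJ : IsMonomial J)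
    (hfin : FiniteDimensional K (PS n K ⧸ J)) : ∃ N, ContainsDegree J N := by
  classical
  have hli : LinearIndependent K (fun v : {v : Fin n →₀ ℕ // mono K v ∉ J} =>
      Ideal.Quotient.mkₐ K J (mono K v.1)) := by
    rw [linearIndependent_iff']
    intro s c hs v hv
    by_contra hne
    have h1 : ∑ u ∈ s, c u • mono K u.1 ∈ J := by
      rw [← Ideal.Quotient.eq_zero_iff_mem, ← Ideal.Quotient.mkₐ_eq_mk K, map_sum]
      simpa using hs
    refine v.2 (hJ.mem_iff.1 h1 v.1 ?_)
    rw [map_sum, Finset.sum_eq_single v]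
    · rw [coeff_smul, coeff_mono, if_pos rfl, mul_one]
      exact hne
    · intro u _ hu
      rw [coeff_smul, coeff_mono, if_neg (fun h => hu (Subtype.ext h.symm)), mul_zero]
    · exact fun h => absurd hv h
  have : Finite {v : Fin n →₀ ℕ // mono K v ∉ J} := hli.finite
  have hfin' : {v : Fin n →₀ ℕ | mono K v ∉ J}.Finite := this
  refine ⟨hfin'.toFinset.sup Finsupp.degree + 1, fun v hv => ?_⟩
  by_contra hne
  have : v.degree ≤ hfin'.toFinset.sup Finsupp.degree :=
    Finset.le_sup (f := Finsupp.degree) (hfin'.mem_toFinset.2 hne)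
  omega

/-- The properties of the measuring sequence of a family of monomial ideals of finite colength
which determine the structure of `G A`. -/
structure IsMeasuring (A : Fin n → Ideal (PS n K)) (N : ℕ) : Prop where
  isMonomial : ∀ i, IsMonomial (A i)
  X_mem : ∀ i, X i ∈ A i
  constantCoeff_eq_zero : ∀ i, ∀ f ∈ A i, constantCoeff f = 0
  containsDegree : ∀ i, ContainsDegree (A i) N
  transvection_mem : ∀ (i : Fin n) (v : Fin n →₀ ℕ) (c : K) (g : Aut n K), mono K v ∈ A i →
    v i = 0 → IsTransvection g i (c • mono K v) → g ∈ G A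

theorem isMeasuring_of_containsDegree {r : ℕ} {I : Fin r → Ideal (PS n K)}
    (hI : ∀ k, IsMonomial (I k)) {N : ℕ} (hN : ∀ k, ContainsDegree (I k) N) :
    IsMeasuring (measuring I) (N + 1) := by
  have hspan := measuring_eq_span hI hN
  have hmonomial : ∀ i, IsMonomial (measuring I i) := fun i => ⟨_, hspan i⟩
  have hXmem : ∀ i, (X i : PS n K) ∈ measuring I i := fun i =>
    Ideal.subset_span ⟨1, fun j _ => rfl, fun k => one_mem (G I) k, rfl⟩
  refine ⟨hmonomial, hXmem, ?_, ?_, ?_⟩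
  · intro i f hf
    have : measuring I i ≤ IsLocalRing.maximalIdeal (PS n K) := by
      rw [measuring, Ideal.span_le]
      rintro _ ⟨g, -, -, rfl⟩
      exact mem_maximalIdeal.2 (constantCoeff_aut_X g i)
    exact mem_maximalIdeal.1 (this hf)
  · intro i v hv
    by_cases hvi : v i = 0
    · rw [hspan]
      refine Ideal.subset_span ⟨v, Or.inr ⟨hvi, ?_, fun k => ?_⟩, rfl⟩
      · rintro rfl
        simp at hv
      · exact admissible_of_mono_mem (hN k v (by omega))
    · refine mono_mem_of_le (u := Finsupp.single i 1) ?_ (hXmem i)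
      rw [Finsupp.single_le_iff]
      exact Nat.one_le_iff_ne_zero.2 hvi
  · intro i v c t hv hvi ht
    have hadm : ∀ k, Admissible (I k) i v := by
      rw [hspan, mem_span_mono] at hv
      obtain ⟨u, hu, huv⟩ := hv v (by rw [coeff_mono, if_pos rfl]; exact one_ne_zero)
      rcases hu with rfl | ⟨-, -, hu⟩
      · rw [Finsupp.single_le_iff, hvi] at huv
        exact absurd huv (by norm_num)
      · exact fun k => (hu k).mono_le huv
    have htI : t ∈ G I := fun k => ht.fixes (hI k) (hadm k)
    have hinv : ∀ {y}, t y = y → (t⁻¹ : Aut n K) y = y := fun {y} hy => by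
      conv_lhs => rw [← hy]
      change (t⁻¹ * t : Aut n K) y = y
      rw [inv_mul_cancel]
      rfl
    intro j
    refine fixes_of_map_mem ?_
    by_cases hji : j = i
    -- For `j = i`, composing with `t` permutes the defining generators of `A_i`.
    · subst hji
      suffices h : measuring I j ≤ (measuring I j).comap (t : PS n K →+* PS n K) from
        fun f hf => h hf
      conv_lhs => rw [measuring]
      rw [Ideal.span_le]
      rintro _ ⟨g, hg, hgI, rfl⟩
      refine Ideal.subset_span ⟨t * g, fun l hl => ?_, fun k => mul_mem htI hgI k, rfl⟩
      change t (g (X l)) = X l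
      rw [hg l hl, ht.2 l hl]
    · by_cases hvj : v j = 0
      -- Conjugation by `t` acts on the automorphisms defining `A_j`: since `x^v` is free of `x_j`,
      -- such a `g` fixes `x^v`, and `t * g * t⁻¹` still fixes `x_i`.
      · suffices h : measuring I j ≤ (measuring I j).comap (t : PS n K →+* PS n K) from
          fun f hf => h hf
        conv_lhs => rw [measuring]
        rw [Ideal.span_le]
        rintro _ ⟨g, hg, hgI, rfl⟩
        refine Ideal.subset_span ⟨t * g * t⁻¹, fun l hl => ?_,
          fun k => mul_mem (mul_mem htI hgI) (inv_mem htI) k, ?_⟩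
        · change t (g ((t⁻¹ : Aut n K) (X l))) = X l
          by_cases hli : l = i
          · subst hli
            have h1 : (t⁻¹ : Aut n K) (X l) = X l - c • mono K v := by
              have h2 : t (X l - c • mono K v) = X l := by
                rw [map_sub, ht.1, aut_map_of_free ht.2 (isFree_smul_mono hvi c),
                  add_sub_cancel_right]
              conv_lhs => rw [← h2]
              change (t⁻¹ * t : Aut n K) _ = _
              rw [inv_mul_cancel]
              rfl
            rw [h1, map_sub, hg l hl, aut_map_of_free hg (isFree_smul_mono hvj c), map_sub, ht.1,
              aut_map_of_free ht.2 (isFree_smul_mono hvi c), add_sub_cancel_right]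
          · rw [hinv (ht.2 l hli), hg l hl, ht.2 l hli]
        · change t (g ((t⁻¹ : Aut n K) (X j))) = t (g (X j))
          rw [hinv (ht.2 j hji)]
      -- Here `t` is the identity modulo `x_j`, which lies in `A_j`.
      · have hXj : (X j : PS n K) ∣ mono K v := by
          rw [mono_eq_pow_mul_erase j]
          exact Dvd.dvd.mul_right (dvd_pow_self _ hvj) _
        have hmono : ∀ u, (X j : PS n K) ∣ t (mono K u) - mono K u := fun u => by
          induction u using mono_induction with
          | h0 => rw [mono_zero, map_one, sub_self]; exact dvd_zero _
          | h1 l u ih =>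
            rw [mono_add, map_mul, mono_single]
            have e : t (X l) * t (mono K u) - X l * mono K u =
              t (X l) * (t (mono K u) - mono K u) + (t (X l) - X l) * mono K u := by ring
            rw [e]
            refine dvd_add (ih.mul_left _) (Dvd.dvd.mul_right ?_ _)
            by_cases hl : l = i
            · rw [hl, ht.1, add_sub_cancel_left]
              exact hXj.trans (Algebra.smul_def c (mono K v) ▸ dvd_mul_left _ _)
            · rw [ht.2 l hl, sub_self]
              exact dvd_zero _
        intro f hf
        refine (hmonomial j).map_mem (t : PS n K →+* PS n K) (fun u hu => ?_) hf
        change t (mono K u) ∈ measuring I j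
        rw [← sub_add_cancel (t (mono K u)) (mono K u)]
        exact add_mem (Ideal.mem_of_dvd _ (hmono u) (hXmem j)) hu

theorem exists_isMeasuring {r : ℕ} {I : Fin r → Ideal (PS n K)}
    (hI : ∀ k, IsMonomial (I k)) (hfin : ∀ k, FiniteDimensional K (PS n K ⧸ I k)) :
    ∃ N, IsMeasuring (measuring I) N := by
  choose N hN using fun k => exists_containsDegree (hI k) (hfin k)
  exact ⟨_, isMeasuring_of_containsDegree hI (N := Finset.univ.sup N) fun k v hv =>
    hN k v ((Finset.le_sup (Finset.mem_univ k)).trans hv)⟩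

end Measuring

/-! ### Levels of variables and maximality of the chain -/

section Chains

variable {n : ℕ} {K : Type*} [Field K]

theorem containsDegree_two_of_sq_le {J : Ideal (PS n K)}
    (h : IsLocalRing.maximalIdeal (PS n K) ^ 2 ≤ J) : ContainsDegree J 2 := by
  intro v hv
  apply h
  have hmono : ∀ u : Fin n →₀ ℕ, u ≠ 0 → mono K u ∈ IsLocalRing.maximalIdeal (PS n K) :=
    fun u hu => by
      rw [mem_maximalIdeal, ← coeff_zero_eq_constantCoeff_apply, coeff_mono, if_neg (Ne.symm hu)]
  have hv0 : v ≠ 0 := by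
    rintro rfl
    simp at hv
  obtain ⟨j, hj⟩ := Finsupp.ne_iff.1 hv0
  have hle : Finsupp.single j 1 ≤ v := by
    rw [Finsupp.single_le_iff]
    exact Nat.one_le_iff_ne_zero.2 hj
  have e : v = v - Finsupp.single j 1 + Finsupp.single j 1 := (tsub_add_cancel_of_le hle).symm
  rw [e, mono_add, pow_two]
  refine Ideal.mul_mem_mul (hmono _ ?_) (hmono _ ?_)
  · intro h0
    rw [h0, zero_add] at e
    rw [e, Finsupp.degree_single] at hv
    omega
  · simp

theorem lin_eq_zero_of_mem_sq {f : PS n K} (hf : f ∈ IsLocalRing.maximalIdeal (PS n K) ^ 2)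
    (j : Fin n) : lin j f = 0 := by
  have h : IsLocalRing.maximalIdeal (PS n K) ^ 2 ≤ wfilt K (fun _ : Fin n => 1) 2 := by
    rw [pow_two, Ideal.mul_le]
    intro a ha b hb
    rw [mem_maximalIdeal, ← mem_wfilt_one (w := fun _ : Fin n => 1) fun _ => Nat.one_pos] at ha hb
    exact mul_mem_wfilt ha hb
  exact coeff_eq_zero_of_mem_wfilt (h hf) (by rw [weight_single_one]; norm_num)

theorem sq_le_of_containsDegree {J : Ideal (PS n K)} (hJ : IsMonomial J)
    (h : ContainsDegree J 2) : IsLocalRing.maximalIdeal (PS n K) ^ 2 ≤ J := by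
  rw [pow_two, Ideal.mul_le]
  intro a ha b hb
  rw [mem_maximalIdeal, ← mem_wfilt_one (w := fun _ : Fin n => 1) fun _ => Nat.one_pos] at ha hb
  refine hJ.mem_iff.2 fun v hv => h v ?_
  rw [degree_eq_weight]
  exact mul_mem_wfilt ha hb v hv

theorem Fixes.X_mem {J : Ideal (PS n K)} (hJ : IsMonomial J) {g : Aut n K} (hg : Fixes g J)
    {i j : Fin n} (hi : X i ∈ J) (h : lin j (g (X i)) ≠ 0) : X j ∈ J :=
  hJ.mem_iff.1 (hg.map_mem hi) _ h

/-- Everything of degree at least 2 lies in `J` and stays in that degree range, so only linear parts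
matter. -/
theorem fixes_of_lin {J : Ideal (PS n K)} (hJ : IsMonomial J) (h2 : ContainsDegree J 2)
    {g : Aut n K} (h : ∀ i, X i ∈ J → ∀ j, lin j (g (X i)) ≠ 0 → X j ∈ J) : Fixes g J := by
  refine fixes_of_map_mem fun f hf => hJ.map_mem (g : PS n K →+* PS n K) (fun v hv => ?_) hf
  change g (mono K v) ∈ J
  rcases eq_zero_or_single_or_two_le_degree v with rfl | ⟨i, rfl⟩ | hdeg
  · rwa [mono_zero, map_one, ← mono_zero]
  · refine hJ.mem_iff.2 fun u hu => ?_
    rcases eq_zero_or_single_or_two_le_degree u with rfl | ⟨j, rfl⟩ | hdeg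
    · exact absurd (constantCoeff_aut_X g i) (by simpa [mono_single] using hu)
    · exact h i hv j hu
    · exact h2 u hdeg
  · refine hJ.mem_iff.2 fun u hu => h2 u ?_
    have h1 := algHom_mem_wfilt (g : PS n K →ₐ[K] PS n K) (algHom_X_mem_wfilt _)
      (mono_mem_wfilt (K := K).2 (degree_eq_weight v ▸ hdeg))
    rw [degree_eq_weight]
    exact h1 u hu

theorem le_of_X_mem {J J' : Ideal (PS n K)} (hJ : IsMonomial J) (h1 : (1 : PS n K) ∉ J)
    (h2 : ContainsDegree J' 2) (h : ∀ i, (X i : PS n K) ∈ J → X i ∈ J') : J ≤ J' := by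
  intro f hf
  refine hJ.map_mem (RingHom.id _) (fun v hv => ?_) hf
  rcases eq_zero_or_single_or_two_le_degree v with rfl | ⟨i, rfl⟩ | hdeg
  · exact absurd hv h1
  · exact h i hv
  · exact h2 v hdeg

/-- The monomial ideal generated by the square of the maximal ideal and a set of variables. -/
def varIdeal (K : Type*) [Field K] (S : Set (Fin n)) : Ideal (PS n K) :=
  supportedIdeal {v | 2 ≤ v.degree ∨ ∃ i ∈ S, Finsupp.single i 1 ≤ v} (by
    rintro a b hab (h | ⟨i, hi, hia⟩)
    · exact Or.inl (h.trans (Finsupp.degree_mono hab))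
    · exact Or.inr ⟨i, hi, hia.trans hab⟩)

theorem isMonomial_varIdeal (S : Set (Fin n)) : IsMonomial (varIdeal K S) :=
  isMonomial_supportedIdeal _ _

theorem containsDegree_varIdeal (S : Set (Fin n)) : ContainsDegree (varIdeal K S) 2 :=
  fun _ hv => mono_mem_supportedIdeal.2 (Or.inl hv)

theorem mono_mem_varIdeal {S : Set (Fin n)} {v : Fin n →₀ ℕ} :
    mono K v ∈ varIdeal K S ↔ 2 ≤ v.degree ∨ ∃ i ∈ S, Finsupp.single i 1 ≤ v :=
  mono_mem_supportedIdeal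

theorem X_mem_varIdeal {S : Set (Fin n)} {i : Fin n} : (X i : PS n K) ∈ varIdeal K S ↔ i ∈ S := by
  rw [← mono_single, mono_mem_varIdeal]
  constructor
  · rintro (h | ⟨j, hj, hle⟩)
    · rw [Finsupp.degree_single] at h
      omega
    · rw [Finsupp.single_le_iff] at hle
      by_cases hij : i = j
      · exact hij ▸ hj
      · rw [Finsupp.single_eq_of_ne (Ne.symm hij)] at hle
        omega
  · exact fun h => Or.inr ⟨i, h, le_rfl⟩

theorem one_notMem_varIdeal (S : Set (Fin n)) : (1 : PS n K) ∉ varIdeal K S := by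
  rw [← mono_zero, mono_mem_varIdeal]
  rintro (h | ⟨j, -, hle⟩)
  · simp at h
  · simp at hle

variable {A : Fin n → Ideal (PS n K)} {N m : ℕ} {B : Fin (m + 1) → Ideal (PS n K)}

theorem IsMeasuring.exists_transvection (hA : IsMeasuring A N) {i j : Fin n} (hij : j ≠ i)
    (hj : X j ∈ A i) (c : K) : ∃ t ∈ G A, IsTransvection t i (c • X j) := by
  obtain ⟨t, ht⟩ := exists_isTransvection_mono i (v := Finsupp.single j 1) (by simp)
    (by simp [hij]) c
  refine ⟨t, hA.transvection_mem i _ c t hj (by simp [hij]) ht, ht⟩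

/-- The map `x_l ↦ x_l + x_j` belongs to `G A`, so it preserves `A i`. -/
theorem IsMeasuring.X_mem_trans (hA : IsMeasuring A N) {i j l : Fin n} (hj : X j ∈ A l)
    (hl : X l ∈ A i) : X j ∈ A i := by
  by_cases hjl : j = l
  · exact hjl ▸ hl
  obtain ⟨t, htA, ht⟩ := hA.exists_transvection hjl hj 1
  have h := (htA i).map_mem hl
  rw [ht.1, one_smul] at h
  exact (Ideal.add_mem_iff_right _ hl).1 h

namespace IsChain

theorem one_notMem (hB : IsChain A B) (k : Fin (m + 1)) : (1 : PS n K) ∉ B k := by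
  intro h
  have h1 := hB.strictMono.monotone (Fin.le_last k) h
  rw [hB.last_eq, mem_maximalIdeal, map_one] at h1
  exact one_ne_zero h1

theorem containsDegree_two (hB : IsChain A B) (k : Fin (m + 1)) : ContainsDegree (B k) 2 :=
  containsDegree_two_of_sq_le (hB.sq_lt.le.trans (hB.strictMono.monotone (Fin.zero_le k)))

theorem exists_X_mem (hB : IsChain A B) (i : Fin n) : ∃ k, X i ∈ B k :=
  ⟨Fin.last m, by rw [hB.last_eq, mem_maximalIdeal, constantCoeff_X]⟩

end IsChain

/-- The index of the first ideal of the chain `B` which contains `x_i`. -/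
noncomputable def level (B : Fin (m + 1) → Ideal (PS n K)) (i : Fin n) : ℕ :=
  sInf {k | ∃ h : k < m + 1, X i ∈ B ⟨k, h⟩}

namespace IsChain

theorem X_mem_iff (hB : IsChain A B) {i : Fin n} {k : Fin (m + 1)} :
    X i ∈ B k ↔ level B i ≤ k := by
  constructor
  · exact fun h => Nat.sInf_le ⟨k.2, h⟩
  · intro h
    obtain ⟨k', hk'⟩ := hB.exists_X_mem i
    obtain ⟨hlt, hmem⟩ := Nat.sInf_mem
      (⟨k', k'.2, hk'⟩ : {k | ∃ h : k < m + 1, X i ∈ B ⟨k, h⟩}.Nonempty)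
    exact hB.strictMono.monotone (show (⟨_, hlt⟩ : Fin (m + 1)) ≤ k from h) hmem

theorem level_le (hB : IsChain A B) (i : Fin n) : level B i ≤ m := by
  have := hB.X_mem_iff (i := i) (k := Fin.last m)
  rw [Fin.val_last] at this
  rw [← this, hB.last_eq, mem_maximalIdeal, constantCoeff_X]

theorem varLE_iff (hB : IsChain A B) {i j : Fin n} : VarLE B i j ↔ level B i ≤ level B j := by
  constructor
  · intro h
    exact hB.X_mem_iff.1 (h ⟨level B j, Nat.lt_succ_of_le (hB.level_le j)⟩ (hB.X_mem_iff.2 le_rfl))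
  · intro h k hk
    exact hB.X_mem_iff.2 (h.trans (hB.X_mem_iff.1 hk))

theorem varLT_iff (hB : IsChain A B) {i j : Fin n} : VarLT B i j ↔ level B i < level B j := by
  rw [VarLT, hB.varLE_iff, hB.varLE_iff]
  omega

theorem level_le_of_lin (hB : IsChain A B) {g : Aut n K} (hg : g ∈ G B) {i j : Fin n}
    (h : lin j (g (X i)) ≠ 0) : level B j ≤ level B i :=
  hB.X_mem_iff.1 ((hg ⟨level B i, Nat.lt_succ_of_le (hB.level_le i)⟩).X_mem (hB.isMonomial _)
    (hB.X_mem_iff.2 le_rfl) h)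

end IsChain

theorem IsMaxChain.X_mem_of_level_eq (hB : IsMaxChain A B) (hA : IsMeasuring A N) {i j : Fin n}
    (hij : level B i = level B j) : X j ∈ A i := by
  have hC := hB.toIsChain
  by_contra hj
  -- If `x_j ∉ A_i`, this set contains `i` but not `j`, so its ideal lies strictly between two
  -- neighbours of the chain; it is `G A`-stable because membership of variables in the `A_l` is
  -- transitive.
  let S : Set (Fin n) := {l | level B l < level B i ∨ (level B l = level B i ∧ X l ∈ A i)}
  have hfix : ∀ g ∈ G A, Fixes g (varIdeal K S) := by
    intro g hg
    refine fixes_of_lin (isMonomial_varIdeal S) (containsDegree_varIdeal S) fun l hl p hp => ?_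
    rw [X_mem_varIdeal] at hl ⊢
    have h1 := hC.level_le_of_lin (hC.le hg) hp
    have h2 : X p ∈ A l := (hg l).X_mem (hA.isMonomial l) (hA.X_mem l) hp
    rcases hl with hl | ⟨hl, hlA⟩
    · exact Or.inl (h1.trans_lt hl)
    · rcases (h1.trans hl.le).lt_or_eq with h | h
      · exact Or.inl h
      · exact Or.inr ⟨h, hA.X_mem_trans h2 hlA⟩
  have hiS : i ∈ S := Or.inr ⟨rfl, hA.X_mem i⟩
  have hjS : j ∉ S := by
    rintro (h | ⟨-, h⟩)
    · omega
    · exact hj h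
  have hle := hC.level_le i
  have hlow : ∀ (k : Fin (m + 1)), (k : ℕ) < level B i → B k < varIdeal K S := by
    intro k hk
    refine lt_of_le_of_ne (le_of_X_mem (hC.isMonomial k) (hC.one_notMem k)
      (containsDegree_varIdeal S) fun l hl => X_mem_varIdeal.2
        (Or.inl ((hC.X_mem_iff.1 hl).trans_lt hk))) ?_
    intro h
    have := hC.X_mem_iff.1 (h ▸ X_mem_varIdeal.2 hiS : X i ∈ B k)
    omega
  have hhigh : ∀ (k : Fin (m + 1)), level B i ≤ (k : ℕ) → varIdeal K S < B k := by
    intro k hk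
    refine lt_of_le_of_ne (le_of_X_mem (isMonomial_varIdeal S) (one_notMem_varIdeal S)
      (hC.containsDegree_two k) fun l hl => hC.X_mem_iff.2 ?_) ?_
    · rcases X_mem_varIdeal.1 hl with h | ⟨h, -⟩ <;> omega
    · intro h
      exact hjS (X_mem_varIdeal.1 (h ▸ hC.X_mem_iff.2 (hij ▸ hk) : X j ∈ varIdeal K S))
  have hsq : IsLocalRing.maximalIdeal (PS n K) ^ 2 < varIdeal K S := by
    refine lt_of_le_of_ne (sq_le_of_containsDegree (isMonomial_varIdeal S)
      (containsDegree_varIdeal S)) fun h => ?_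
    have h1 := lin_eq_zero_of_mem_sq (h ▸ X_mem_varIdeal.2 hiS : (X i : PS n K) ∈ _) i
    rw [lin_X, if_pos rfl] at h1
    exact one_ne_zero h1
  -- The new ideal takes position `level B i`. At position 0 it becomes the first term, which is why
  -- `hsq` is needed.
  let B' : Fin (m + 1 + 1) → Ideal (PS n K) := fun t =>
    if h : (t : ℕ) < level B i then B ⟨t, by omega⟩
    else if (t : ℕ) = level B i then varIdeal K S else B ⟨t - 1, by omega⟩
  have hB' : IsChain A B' := by
    refine ⟨fun t => ?_, ?_, ?_, ?_, fun g hg t => ?_⟩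
    · simp only [B']
      split_ifs
      exacts [hC.isMonomial _, isMonomial_varIdeal S, hC.isMonomial _]
    · rcases Nat.eq_zero_or_pos (level B i) with h | h
      · have e : B' 0 = varIdeal K S := by simp [B', h]
        exact e ▸ hsq
      · have e : B' 0 = B 0 := by simp [B', h]
        exact e ▸ hC.sq_lt
    · rw [Fin.strictMono_iff_lt_succ]
      intro t
      simp only [B', Fin.val_castSucc, Fin.val_succ]
      split_ifs with h1 h2 h3 h4 h5 h6 h7
      all_goals first
        | omega
        | exact hlow _ h1
        | exact hhigh _ (by simp only; omega)
        | exact hC.strictMono (Fin.lt_def.2 (by simp only; omega))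
    · simp only [B', Fin.val_last]
      rw [dif_neg (by omega), if_neg (by omega)]
      exact hC.last_eq
    · simp only [B']
      split_ifs
      exacts [hC.le hg _, hfix g hg, hC.le hg _]
  have := hB.maximal (m + 1) B' hB'
  omega

end Chains

/-! ### Uniqueness and existence of representatives -/

section Representatives

variable {n : ℕ} {K : Type*} [Field K]
variable {A : Fin n → Ideal (PS n K)} {N m : ℕ} {B : Fin (m + 1) → Ideal (PS n K)}

/-- Weights of the variables, decreasing with the level and such that each product of two variables
is heavier than each variable. -/
noncomputable def varWeight (B : Fin (m + 1) → Ideal (PS n K)) (i : Fin n) : ℕ :=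
  2 * m + 1 - level B i

theorem IsChain.lt_varWeight (hB : IsChain A B) (i : Fin n) : m < varWeight B i := by
  have := hB.level_le i
  unfold varWeight
  omega

theorem IsChain.varWeight_pos (hB : IsChain A B) (i : Fin n) : 0 < varWeight B i :=
  (Nat.zero_le m).trans_lt (hB.lt_varWeight i)

theorem varWeight_le (B : Fin (m + 1) → Ideal (PS n K)) (i : Fin n) :
    varWeight B i ≤ 2 * m + 1 := Nat.sub_le _ _

theorem IsChain.varWeight_lt_iff (hB : IsChain A B) {i j : Fin n} :
    varWeight B i < varWeight B j ↔ level B j < level B i := by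
  have h1 := hB.level_le i
  have h2 := hB.level_le j
  unfold varWeight
  omega

theorem mul_degree_le_weight {w : Fin n → ℕ} {c : ℕ} (h : ∀ i, c ≤ w i) (v : Fin n →₀ ℕ) :
    c * v.degree ≤ Finsupp.weight w v := by
  induction v using mono_induction with
  | h0 => simp
  | h1 i v ih =>
    rw [map_add, map_add, weight_single_one, Finsupp.degree_single, mul_add, mul_one]
    exact add_le_add (h i) ih

theorem weight_le_mul_degree {w : Fin n → ℕ} {c : ℕ} (h : ∀ i, w i ≤ c) (v : Fin n →₀ ℕ) :
    Finsupp.weight w v ≤ c * v.degree := by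
  induction v using mono_induction with
  | h0 => simp
  | h1 i v ih =>
    rw [map_add, map_add, weight_single_one, Finsupp.degree_single, mul_add, mul_one]
    exact add_le_add (h i) ih

/-- The automorphism `g` adds to each variable terms of greater weight only. -/
def IsUnipotent (B : Fin (m + 1) → Ideal (PS n K)) (g : Aut n K) : Prop :=
  ∀ i, g (X i) - X i ∈ wfilt K (varWeight B) (varWeight B i + 1)

theorem IsChain.isUnipotent_of_lin (hB : IsChain A B) {g : Aut n K}
    (h : ∀ i j, lin j (g (X i) - X i) ≠ 0 → level B j < level B i) : IsUnipotent B g := by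
  intro i v hv
  change varWeight B i + 1 ≤ Finsupp.weight (varWeight B) v
  rcases eq_zero_or_single_or_two_le_degree v with rfl | ⟨j, rfl⟩ | hdeg
  · refine absurd ?_ hv
    rw [coeff_zero_eq_constantCoeff_apply, map_sub, constantCoeff_aut_X, constantCoeff_X, sub_zero]
  · rw [weight_single_one]
    exact hB.varWeight_lt_iff.2 (h i j hv)
  · calc varWeight B i + 1 ≤ (m + 1) * 2 := by
          have := varWeight_le B i
          omega
      _ ≤ (m + 1) * v.degree := Nat.mul_le_mul_left _ hdeg
      _ ≤ _ := mul_degree_le_weight (fun i => hB.lt_varWeight i) v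

theorem IsUnipotent.level_lt (hB : IsChain A B) {g : Aut n K} (hg : IsUnipotent B g)
    {i j : Fin n} (h : lin j (g (X i) - X i) ≠ 0) : level B j < level B i := by
  have := hg i _ h
  change _ ≤ Finsupp.weight (varWeight B) _ at this
  rw [weight_single_one] at this
  exact hB.varWeight_lt_iff.1 this

theorem IsUnipotent.mem_G (hB : IsChain A B) {g : Aut n K} (hg : IsUnipotent B g) : g ∈ G B := by
  intro k
  refine fixes_of_lin (hB.isMonomial k) (hB.containsDegree_two k) fun i hi j hj => ?_
  rw [← sub_add_cancel (g (X i)) (X i), lin_add] at hj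
  by_cases hij : j = i
  · exact hij ▸ hi
  · rw [lin_X, if_neg hij, add_zero] at hj
    rw [hB.X_mem_iff] at hi ⊢
    exact (hg.level_lt hB hj).le.trans hi

theorem IsUnipotent.sub_mem (hB : IsChain A B) {g : Aut n K} (hg : IsUnipotent B g)
    {d : ℕ} {f : PS n K} (hf : f ∈ wfilt K (varWeight B) d) :
    g f - f ∈ wfilt K (varWeight B) (d + 1) :=
  algHom_sub_mem_wfilt hB.varWeight_pos (g : PS n K →ₐ[K] PS n K) hg hf

theorem IsUnipotent.fixes_wfilt (hB : IsChain A B) {g : Aut n K} (hg : IsUnipotent B g) (d : ℕ) :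
    Fixes g (wfilt K (varWeight B) d) := fixes_of_map_mem fun f hf => by
  rw [← sub_add_cancel (g f) f]
  exact add_mem (wfilt_anti (Nat.le_succ d) (hg.sub_mem hB hf)) hf

theorem coeff_finsupp_sum_mono (a : (Fin n →₀ ℕ) →₀ K) (v : Fin n →₀ ℕ) :
    coeff v (a.sum fun u c => c • mono K u) = a v := by
  rw [Finsupp.sum, map_sum, Finset.sum_eq_single v]
  · rw [coeff_smul, coeff_mono, if_pos rfl, mul_one]
  · intro u _ hu
    rw [coeff_smul, coeff_mono, if_neg (Ne.symm hu), mul_zero]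
  · intro hv
    rw [Finsupp.notMem_support_iff.1 hv, zero_smul, coeff_zero]

theorem mem_pairs_of_mem_reps {ι : Type*} {B : ι → Ideal (PS n K)} {g : Aut n K}
    (hg : g ∈ reps A B) {i : Fin n} {v : Fin n →₀ ℕ} (hv : coeff v (g (X i) - X i) ≠ 0) :
    (i, v) ∈ pairs A B := by
  obtain ⟨a, ha, hga⟩ := hg
  rw [hga, add_sub_cancel_left, coeff_finsupp_sum_mono] at hv
  exact ha i v (Finsupp.mem_support_iff.2 hv)

theorem isUnipotent_of_mem_reps (hB : IsChain A B) {g : Aut n K} (hg : g ∈ reps A B) :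
    IsUnipotent B g :=
  hB.isUnipotent_of_lin fun _ j hj => hB.varLT_iff.1 ((mem_pairs_of_mem_reps hg hj).2 j rfl)

theorem reps_unique (hA : IsMeasuring A N) (hB : IsChain A B) {g g' h : Aut n K}
    (hg : g ∈ reps A B) (hg' : g' ∈ reps A B) (hh : h ∈ G A) (e : g' = g * h) : g' = g := by
  have hgu := isUnipotent_of_mem_reps hB hg
  refine aut_ext fun i => ?_
  have ha : h (X i) - X i ∈ A i := sub_mem ((hh i).map_mem (hA.X_mem i)) (hA.X_mem i)
  have hD : g (h (X i) - X i) = (g' (X i) - X i) - (g (X i) - X i) := by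
    rw [map_sub, e, sub_sub_sub_cancel_right]
    rfl
  -- Induction on weight: in the lowest weight `g` does not alter coefficients, so a monomial of
  -- `A_i` occurring there would occur in `g' x_i - x_i` or `g x_i - x_i`.
  have hzero : h (X i) - X i = 0 := by
    refine eq_zero_of_forall_mem_wfilt (w := varWeight B) fun d => ?_
    induction d with
    | zero => rw [wfilt_zero]; trivial
    | succ d ih =>
      intro v hv
      change d + 1 ≤ Finsupp.weight (varWeight B) v
      by_contra! hlt
      have hvA : mono K v ∈ A i := (hA.isMonomial i).mem_iff.1 ha v hv
      have h1 := coeff_eq_zero_of_mem_wfilt (hgu.sub_mem hB ih) hlt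
      rw [map_sub, sub_eq_zero, hD, map_sub] at h1
      rw [← h1] at hv
      by_cases h2 : coeff v (g' (X i) - X i) = 0
      · rw [h2, zero_sub, neg_ne_zero] at hv
        exact (mem_pairs_of_mem_reps hg hv).1 hvA
      · exact (mem_pairs_of_mem_reps hg' h2).1 hvA
  rw [hzero, map_zero, sub_sub_sub_cancel_right] at hD
  exact sub_eq_zero.1 hD.symm

/-- If `x_i` divides `x^v = x_i x^u`, a transvection is replaced by multiplication of `x_i` by the
unit `1 + c x^u`. -/
theorem IsMeasuring.exists_transvection_mono (hA : IsMeasuring A N) {i : Fin n} {v : Fin n →₀ ℕ}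
    (hv : mono K v ∈ A i) (hvi : v ≠ Finsupp.single i 1) (c : K) :
    ∃ t ∈ G A, IsTransvection t i (c • mono K v) := by
  by_cases h0 : v i = 0
  · have hv0 : v ≠ 0 := by
      rintro rfl
      have := hA.constantCoeff_eq_zero i _ hv
      rw [mono_zero, map_one] at this
      exact one_ne_zero this
    obtain ⟨t, ht⟩ := exists_isTransvection_mono i hv0 h0 c
    exact ⟨t, hA.transvection_mem i v c t hv h0 ht, ht⟩
  · have hle : Finsupp.single i 1 ≤ v := by
      rw [Finsupp.single_le_iff]
      exact Nat.one_le_iff_ne_zero.2 h0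
    obtain ⟨u, rfl⟩ := exists_add_of_le hle
    have hu : u ≠ 0 := by
      rintro rfl
      exact hvi (add_zero _)
    have hq : constantCoeff (1 + c • mono K u) ≠ 0 := by
      rw [← coeff_zero_eq_constantCoeff_apply, map_add, coeff_smul, coeff_mono,
        if_neg (Ne.symm hu), mul_zero, add_zero]
      simp
    obtain ⟨t, hti, htj⟩ := exists_aut_mul_unit i hq
    refine ⟨t, fun k => fixes_of_dvd (hA.isMonomial k) fun j => ?_, ?_, htj⟩
    · by_cases hj : j = i
      · rw [hj, hti]
        exact dvd_mul_right _ _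
      · rw [htj j hj]
    · rw [hti, mono_add, mono_single, mul_add, mul_one, mul_smul_comm]

/-- The monomials of `A_i` of weight less than `d` do not occur in `g(x_i) - x_i`. -/
def IsReducedBelow (A : Fin n → Ideal (PS n K)) (B : Fin (m + 1) → Ideal (PS n K)) (d : ℕ)
    (g : Aut n K) : Prop :=
  ∀ i v, mono K v ∈ A i → Finsupp.weight (varWeight B) v < d → coeff v (g (X i) - X i) = 0

/-- Coefficients of one weight `d` can be cleared one at a time, as each correction has no other
effect in weight at most `d`. -/
theorem exists_reduced_finset (hA : IsMeasuring A N) (hB : IsChain A B) {f : Aut n K} {d : ℕ}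
    (hf : IsUnipotent B f) (hfd : IsReducedBelow A B d f)
    (Q : Finset (Fin n × (Fin n →₀ ℕ))) (hQ : ∀ q ∈ Q, Finsupp.weight (varWeight B) q.2 = d) :
    ∃ p ∈ G A, IsUnipotent B (f * p) ∧ IsReducedBelow A B d (f * p) ∧
      ∀ q ∈ Q, mono K q.2 ∈ A q.1 → coeff q.2 ((f * p) (X q.1) - X q.1) = 0 := by
  classical
  induction Q using Finset.induction_on with
  | empty => exact ⟨1, one_mem _, by rwa [mul_one], by rwa [mul_one], by simp⟩
  | insert q Q hq ih =>
    obtain ⟨p, hpA, hpu, hpd, hpQ⟩ := ih fun q' hq' => hQ q' (Finset.mem_insert_of_mem hq')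
    by_cases hskip : mono K q.2 ∈ A q.1 → coeff q.2 ((f * p) (X q.1) - X q.1) = 0
    · refine ⟨p, hpA, hpu, hpd, fun q' hq' => ?_⟩
      rcases Finset.mem_insert.1 hq' with rfl | hq'
      · exact hskip
      · exact hpQ q' hq'
    · obtain ⟨i, v⟩ := q
      push Not at hskip
      obtain ⟨hvA, hc⟩ := hskip
      simp only at hvA hc
      have hvd : Finsupp.weight (varWeight B) v = d := hQ (i, v) (Finset.mem_insert_self _ _)
      have hid : varWeight B i + 1 ≤ d := hvd ▸ hpu i v hc
      obtain ⟨c, hcdef⟩ : ∃ c, c = coeff v ((f * p) (X i) - X i) := ⟨_, rfl⟩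
      have hvi : v ≠ Finsupp.single i 1 := by
        rintro rfl
        rw [weight_single_one] at hvd
        omega
      obtain ⟨t, htA, hti, htj⟩ := hA.exists_transvection_mono hvA hvi (-c)
      have hmv : mono K v ∈ wfilt K (varWeight B) d := mono_mem_wfilt.2 hvd.ge
      have hnew : ∀ j, (f * (p * t)) (X j) - X j - ((f * p) (X j) - X j) ∈
          wfilt K (varWeight B) (if j = i then d else d + 1) := fun j => by
        rw [← mul_assoc]
        change (f * p) (t (X j)) - X j - _ ∈ _
        split_ifs with hj
        · rw [hj, hti, map_add, map_smul]
          have e : (f * p) (X i) + -c • (f * p) (mono K v) - X i - ((f * p) (X i) - X i) =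
            -c • (f * p) (mono K v) := by ring
          rw [e]
          exact Submodule.smul_of_tower_mem _ _ ((hpu.fixes_wfilt hB d).map_mem hmv)
        · rw [htj j hj, sub_self]
          exact zero_mem _
      -- Unipotence makes `(f * p) (x^v)` equal to `x^v` up to larger weight, so in weight `d` only
      -- the coefficient of `x^v` changes.
      have hnewi : (f * (p * t)) (X i) - X i - ((f * p) (X i) - X i) + c • mono K v ∈
          wfilt K (varWeight B) (d + 1) := by
        rw [← mul_assoc]
        change (f * p) (t (X i)) - X i - _ + _ ∈ _
        rw [hti, map_add, map_smul]
        have e : (f * p) (X i) + -c • (f * p) (mono K v) - X i - ((f * p) (X i) - X i) +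
            c • mono K v = -c • ((f * p) (mono K v) - mono K v) := by
          rw [smul_sub, neg_smul, neg_smul]
          ring
        rw [e]
        exact Submodule.smul_of_tower_mem _ _ (hpu.sub_mem hB hmv)
      refine ⟨p * t, mul_mem hpA htA, fun j => ?_, fun j u hu hud => ?_, ?_⟩
      · rw [← sub_add_cancel ((f * (p * t)) (X j) - X j) ((f * p) (X j) - X j)]
        refine add_mem ?_ (hpu j)
        by_cases hj : j = i
        · have := hnew j
          rw [if_pos hj] at this
          exact wfilt_anti (hj ▸ hid) this
        · rw [← mul_assoc]
          change (f * p) (t (X j)) - X j - _ ∈ _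
          rw [htj j hj, sub_self]
          exact zero_mem _
      · have h1 := coeff_eq_zero_of_mem_wfilt (hnew j) (v := u)
          (hud.trans_le (by split_ifs <;> omega))
        rw [map_sub, sub_eq_zero] at h1
        rw [h1, hpd j u hu hud]
      · rintro ⟨j, u⟩ hju huA
        simp only at huA ⊢
        have hud : Finsupp.weight (varWeight B) u = d := hQ (j, u) hju
        by_cases hj : j = i
        · subst hj
          have h1 := coeff_eq_zero_of_mem_wfilt hnewi (v := u) (by omega)
          rw [map_add, map_sub, coeff_smul, coeff_mono] at h1
          by_cases huv : u = v
          · rw [if_pos huv, mul_one, huv, ← hcdef, sub_add_cancel] at h1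
            rw [huv]
            exact h1
          · rw [if_neg huv, mul_zero, add_zero, sub_eq_zero] at h1
            rw [h1]
            refine hpQ (j, u) ?_ huA
            rcases Finset.mem_insert.1 hju with h | h
            · exact absurd (Prod.ext_iff.1 h).2 huv
            · exact h
        · have h1 := hnew j
          rw [if_neg hj] at h1
          have h2 := coeff_eq_zero_of_mem_wfilt h1 (v := u) (by omega)
          rw [map_sub, sub_eq_zero] at h2
          rw [h2]
          refine hpQ (j, u) ?_ huA
          rcases Finset.mem_insert.1 hju with h | h
          · exact absurd (Prod.ext_iff.1 h).1 hj
          · exact h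

theorem exists_reduced (hA : IsMeasuring A N) (hB : IsChain A B) {f : Aut n K}
    (hf : IsUnipotent B f) (d : ℕ) :
    ∃ p ∈ G A, IsUnipotent B (f * p) ∧ IsReducedBelow A B d (f * p) := by
  induction d with
  | zero =>
    exact ⟨1, one_mem _, by rwa [mul_one], fun i v _ h => absurd h (Nat.not_lt_zero _)⟩
  | succ d ih =>
    obtain ⟨p, hpA, hpu, hpd⟩ := ih
    let F : Finset (Fin n →₀ ℕ) := ((Finsupp.finite_of_degree_le d).toFinset).filter
      fun v => Finsupp.weight (varWeight B) v = d
    obtain ⟨t, htA, htu, htd, ht⟩ := exists_reduced_finset hA hB hpu hpd (Finset.univ ×ˢ F)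
      (fun q hq => (Finset.mem_filter.1 (Finset.mem_product.1 hq).2).2)
    rw [mul_assoc] at htu htd ht
    refine ⟨p * t, mul_mem hpA htA, htu, fun i v hv hvd => ?_⟩
    rcases (Nat.lt_succ_iff.1 hvd).lt_or_eq with hlt | heq
    · exact htd i v hv hlt
    · refine ht (i, v) ?_ hv
      simp only [Finset.mem_product, Finset.mem_univ, true_and, F, Finset.mem_filter,
        Set.Finite.mem_toFinset, Set.mem_ofPred_eq]
      refine ⟨?_, heq⟩
      have := mul_degree_le_weight (fun i => hB.varWeight_pos i) v
      omega

/-- Invertible matrices are products of diagonal matrices and transvections. Diagonal maps preserve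
all monomial ideals; transvections within a level lie in `G A` by maximality of the chain. -/
theorem exists_block_mem_G (hA : IsMeasuring A N) (hB : IsMaxChain A B) (k : ℕ)
    (M : Matrix {i // level B i = k} {i // level B i = k} K) (hM : M.det ≠ 0) :
    ∃ p ∈ G A, (∀ i : {i // level B i = k}, p (X i.1) = ∑ j, M i j • X j.1) ∧
      ∀ i, level B i ≠ k → p (X i) = X i := by
  classical
  refine Matrix.diagonal_transvection_induction_of_det_ne_zero
    (fun M => ∃ p ∈ G A, (∀ i : {i // level B i = k}, p (X i.1) = ∑ j, M i j • X j.1) ∧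
      ∀ i, level B i ≠ k → p (X i) = X i) M hM (fun D hD => ?_) (fun t => ?_) ?_
  · rw [Matrix.det_diagonal] at hD
    have hD' : ∀ i, D i ≠ 0 := fun i => Finset.prod_ne_zero_iff.1 hD i (Finset.mem_univ i)
    obtain ⟨p, hp⟩ := exists_aut_smul (K := K)
      (fun i : Fin n => if h : level B i = k then D ⟨i, h⟩ else 1)
      (fun i => by split_ifs; exacts [hD' _, one_ne_zero])
    refine ⟨p, fun l => fixes_of_dvd (hA.isMonomial l) fun i => ?_, fun i => ?_, fun i hi => ?_⟩
    · rw [hp, Algebra.smul_def]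
      exact dvd_mul_left _ _
    · rw [hp, dif_pos i.2, Finset.sum_eq_single i]
      · rw [Matrix.diagonal_apply_eq]
      · intro j _ hj
        rw [Matrix.diagonal_apply_ne _ (Ne.symm hj), zero_smul]
      · exact fun h => absurd (Finset.mem_univ i) h
    · rw [hp, dif_neg hi, one_smul]
  · obtain ⟨i, j, hij, c⟩ := t
    obtain ⟨p, hpA, hpi, hpj⟩ := hA.exists_transvection (i := i.1) (j := j.1)
      (fun h => hij (Subtype.ext h.symm)) (hB.X_mem_of_level_eq hA (i.2.trans j.2.symm)) c
    refine ⟨p, hpA, fun l => ?_, fun l hl => hpj l fun h => hl (h ▸ i.2)⟩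
    have e : ∑ s, (Matrix.TransvectionStruct.toMatrix ⟨i, j, hij, c⟩) l s • (X s.1 : PS n K) =
        X l.1 + if l = i then c • X j.1 else 0 := by
      simp only [Matrix.TransvectionStruct.toMatrix, Matrix.transvection, Matrix.add_apply,
        add_smul, Finset.sum_add_distrib]
      congr 1
      · rw [Finset.sum_eq_single l]
        · rw [Matrix.one_apply_eq, one_smul]
        · intro s _ hs
          rw [Matrix.one_apply_ne (Ne.symm hs), zero_smul]
        · exact fun h => absurd (Finset.mem_univ l) h
      · rw [Finset.sum_eq_single j]
        · by_cases hl : l = i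
          · rw [hl, if_pos rfl, Matrix.single_apply_same]
          · rw [if_neg hl, Matrix.single_apply_of_row_ne (Ne.symm hl), zero_smul]
        · intro s _ hs
          rw [Matrix.single_apply_of_col_ne _ _ (Ne.symm hs), zero_smul]
        · exact fun h => absurd (Finset.mem_univ j) h
    rw [e]
    by_cases hl : l = i
    · rw [if_pos hl, hl, hpi]
    · rw [if_neg hl, add_zero, hpj _ fun h => hl (Subtype.ext h)]
  · rintro M M' - - ⟨p, hpA, hp, hpX⟩ ⟨p', hpA', hp', hpX'⟩
    -- Images of variables are the rows of the matrix, so composition reverses the order of the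
    -- product.
    refine ⟨p' * p, mul_mem hpA' hpA, fun i => ?_, fun i hi => ?_⟩
    · change p' (p (X i.1)) = _
      simp only [hp, map_sum, map_smul, hp', Matrix.mul_apply, Finset.smul_sum, Finset.sum_smul,
        smul_smul]
      exact Finset.sum_comm
    · change p' (p (X i)) = _
      rw [hpX i hi, hpX' i hi]

theorem lin_mul_inv (f : Aut n K) (i l : Fin n) :
    ∑ j, lin j ((f⁻¹ : Aut n K) (X i)) * lin l (f (X j)) = if l = i then 1 else 0 := by
  rw [← lin_aut, ← lin_X]
  congr 1
  change (f * f⁻¹ : Aut n K) (X i) = X i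
  rw [mul_inv_cancel]
  rfl

/-- Block triangularity: a nonzero term forces `level B l ≤ level B j ≤ level B i`, so the diagonal
blocks of `f` and `f⁻¹` are mutually inverse. -/
theorem IsChain.lin_mul_inv_level (hB : IsChain A B) {f : Aut n K} (hf : f ∈ G B) {i l : Fin n}
    (hil : level B l = level B i) :
    ∑ j with level B j = level B i, lin j ((f⁻¹ : Aut n K) (X i)) * lin l (f (X j)) =
      if l = i then 1 else 0 := by
  rw [← lin_mul_inv f i l]
  refine Finset.sum_subset (Finset.subset_univ _) fun j _ hj => ?_
  by_contra hne
  have h1 := hB.level_le_of_lin (inv_mem hf) (left_ne_zero_of_mul hne)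
  have h2 := hB.level_le_of_lin hf (right_ne_zero_of_mul hne)
  exact hj (Finset.mem_filter.2 ⟨Finset.mem_univ _, by omega⟩)

theorem exists_isUnipotent (hA : IsMeasuring A N) (hB : IsMaxChain A B) {f : Aut n K}
    (hf : f ∈ G B) : ∃ p ∈ G A, IsUnipotent B (f * p) := by
  classical
  have hC := hB.toIsChain
  let L : Fin n → PS n K := fun i =>
    ∑ j with level B j = level B i, lin j ((f⁻¹ : Aut n K) (X i)) • X j
  have hblock : ∀ k, ∃ p ∈ G A, (∀ i, level B i = k → p (X i) = L i) ∧
      ∀ i, level B i ≠ k → p (X i) = X i := fun k => by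
    let M : Matrix {i // level B i = k} {i // level B i = k} K :=
      Matrix.of fun i j => lin j.1 ((f⁻¹ : Aut n K) (X i.1))
    let M' : Matrix {i // level B i = k} {i // level B i = k} K :=
      Matrix.of fun i j => lin j.1 (f (X i.1))
    have hMM' : M * M' = 1 := by
      ext i l
      rw [Matrix.mul_apply, Matrix.one_apply]
      have h1 := hC.lin_mul_inv_level hf (l.2.trans i.2.symm)
      rw [i.2, Finset.sum_subtype (p := fun j => level B j = k) _ (by simp)] at h1
      simp only [M, M', Matrix.of_apply]
      rw [h1]
      simp only [Subtype.ext_iff, eq_comm]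
    have hdet : M.det ≠ 0 := fun h0 => by
      have := congrArg Matrix.det hMM'
      rw [Matrix.det_mul, h0, zero_mul, Matrix.det_one] at this
      exact zero_ne_one this
    obtain ⟨p, hpA, hp, hpX⟩ := exists_block_mem_G hA hB k M hdet
    refine ⟨p, hpA, fun i hi => ?_, hpX⟩
    rw [hp ⟨i, hi⟩]
    simp only [L]
    rw [hi, Finset.sum_subtype (p := fun j => level B j = k) _ (by simp)]
    rfl
  -- Each `L i` involves only variables of the level of `x_i`, so the corrections for different
  -- levels do not interact.
  have hall : ∀ s : Finset ℕ, ∃ p ∈ G A, ∀ i, p (X i) = if level B i ∈ s then L i else X i := by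
    intro s
    induction s using Finset.induction_on with
    | empty => exact ⟨1, one_mem _, fun i => by simp⟩
    | insert k s hk ih =>
      obtain ⟨p, hpA, hp⟩ := ih
      obtain ⟨t, htA, ht, htX⟩ := hblock k
      refine ⟨p * t, mul_mem hpA htA, fun i => ?_⟩
      change p (t (X i)) = _
      by_cases hi : level B i = k
      · rw [ht i hi, if_pos (by rw [hi]; exact Finset.mem_insert_self _ _), map_sum]
        refine Finset.sum_congr rfl fun j hj => ?_
        rw [map_smul, hp, if_neg]
        rw [(Finset.mem_filter.1 hj).2, hi]
        exact hk
      · rw [htX i hi, hp]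
        simp [hi]
  obtain ⟨p, hpA, hp⟩ := hall (Finset.range (m + 1))
  refine ⟨p, hpA, hC.isUnipotent_of_lin fun i l hl => ?_⟩
  have e : lin l ((f * p) (X i)) =
      ∑ j with level B j = level B i, lin j ((f⁻¹ : Aut n K) (X i)) * lin l (f (X j)) := by
    change lin l (f (p (X i))) = _
    rw [hp, if_pos (Finset.mem_range.2 (Nat.lt_succ_of_le (hC.level_le i))), map_sum, lin_sum]
    simp only [map_smul, lin_smul]
  rw [lin_sub, e, lin_X] at hl
  by_contra! hlt
  apply hl
  rcases hlt.eq_or_lt with heq | hlt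
  · rw [hC.lin_mul_inv_level hf heq.symm, sub_self]
  · rw [if_neg, sub_zero]
    · refine Finset.sum_eq_zero fun j hj => ?_
      by_contra hne
      have := hC.level_le_of_lin hf (right_ne_zero_of_mul hne)
      rw [(Finset.mem_filter.1 hj).2] at this
      omega
    · rintro rfl
      exact lt_irrefl _ hlt

theorem exists_mem_reps (hA : IsMeasuring A N) (hB : IsMaxChain A B) {f : Aut n K}
    (hf : f ∈ G B) : ∃ g ∈ reps A B, ∃ h ∈ G A, f = g * h := by
  classical
  have hC := hB.toIsChain
  obtain ⟨p₁, hp₁, hu₁⟩ := exists_isUnipotent hA hB hf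
  -- No variable weighs more than `2 * m + 1`, so weight at least `M` forces degree at least `N`,
  -- where all monomials lie in every `A_i`.
  obtain ⟨M, hM⟩ : ∃ M, M = (2 * m + 1) * N := ⟨_, rfl⟩
  obtain ⟨p₂, hp₂, hu, hred⟩ := exists_reduced hA hC hu₁ M
  obtain ⟨f', hf'⟩ : ∃ f', f' = f * p₁ * p₂ := ⟨_, rfl⟩
  rw [← hf'] at hu hred
  have hMA : ∀ i, wfilt K (varWeight B) M ≤ A i := fun i y hy =>
    (hA.isMonomial i).mem_iff.2 fun v hv => hA.containsDegree i v (by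
      have h1 := hy v hv
      have h2 := weight_le_mul_degree (varWeight_le B) v
      exact Nat.le_of_mul_le_mul_left ((hM ▸ h1 : (2 * m + 1) * N ≤ _).trans h2) (by omega))
  let a : Fin n → (Fin n →₀ ℕ) →₀ K := fun i =>
    Finsupp.onFinset (Finsupp.finite_of_degree_le M).toFinset
      (fun v => if Finsupp.weight (varWeight B) v < M then coeff v (f' (X i) - X i) else 0)
      (fun v hv => by
        rw [Set.Finite.mem_toFinset, Set.mem_ofPred_eq]
        have hlt : Finsupp.weight (varWeight B) v < M := by
          by_contra h
          exact hv (if_neg h)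
        have := mul_degree_le_weight (fun i => hC.varWeight_pos i) v
        omega)
  have ha : ∀ i v, a i v =
      if Finsupp.weight (varWeight B) v < M then coeff v (f' (X i) - X i) else 0 := fun i v => rfl
  have ha0 : ∀ i v, a i v ≠ 0 →
      Finsupp.weight (varWeight B) v < M ∧ coeff v (f' (X i) - X i) ≠ 0 := fun i v hv => by
    rw [ha] at hv
    split_ifs at hv with h
    · exact ⟨h, hv⟩
    · exact absurd rfl hv
  obtain ⟨g, hg⟩ := exists_aut_of_unipotent hC.varWeight_pos
    (fun i => X i + (a i).sum fun v c => c • mono K v) (fun i v hv => by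
      rw [add_sub_cancel_left, coeff_finsupp_sum_mono] at hv
      exact hu i v (ha0 i v hv).2)
  have hgr : g ∈ reps A B := by
    refine ⟨a, fun i v hv => ?_, hg⟩
    obtain ⟨h1, h2⟩ := ha0 i v (Finsupp.mem_support_iff.1 hv)
    refine ⟨fun hvA => h2 (hred i v hvA h1), ?_⟩
    rintro j rfl
    exact hC.varLT_iff.2 (hu.level_lt hC h2)
  have hgf : ∀ i, g (X i) - f' (X i) ∈ wfilt K (varWeight B) M := fun i v hv => by
    change M ≤ Finsupp.weight (varWeight B) v
    by_contra! hlt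
    apply hv
    have e : g (X i) - f' (X i) = (g (X i) - X i) - (f' (X i) - X i) := by ring
    rw [e, map_sub, hg, add_sub_cancel_left, coeff_finsupp_sum_mono, ha, if_pos hlt, sub_self]
  -- `g` and `f'` agree on variables below weight `M`, and `f'⁻¹` preserves the filtration, so the
  -- quotient is the identity modulo every `A k`.
  have hq : f'⁻¹ * g ∈ G A := fun k => by
    refine fixes_of_sub_mem (hA.isMonomial k) fun i => hMA k ?_
    have e : (f'⁻¹ * g) (X i) - X i = (f'⁻¹ : Aut n K) (g (X i) - f' (X i)) := by
      rw [map_sub]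
      congr 1
      change X i = (f'⁻¹ * f' : Aut n K) (X i)
      rw [inv_mul_cancel]
      rfl
    rw [e]
    exact fixes_inv_mem (hu.fixes_wfilt hC M) (hgf i)
  refine ⟨g, hgr, (p₁ * p₂ * (f'⁻¹ * g))⁻¹, inv_mem (mul_mem (mul_mem hp₁ hp₂) hq), ?_⟩
  rw [hf']
  group

end Representatives

end Alignment

theorem lemma3p3 {K : Type*} [Field K] {n r m : ℕ}
    (I : Fin r → Ideal (Alignment.PS n K))
    (hmon : ∀ k, Alignment.IsMonomial (I k))
    (hfin : ∀ k, FiniteDimensional K (Alignment.PS n K ⧸ I k))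
    (B : Fin (m + 1) → Ideal (Alignment.PS n K))
    (hB : Alignment.IsMaxChain (Alignment.measuring I) B) :
    Alignment.reps (Alignment.measuring I) B ⊆ (Alignment.G B : Set (Alignment.Aut n K)) ∧
    ∀ f ∈ Alignment.G B, ∃! g : Alignment.Aut n K,
      g ∈ Alignment.reps (Alignment.measuring I) B ∧
      ∃ h ∈ Alignment.G (Alignment.measuring I), f = g * h := by
  obtain ⟨N, hA⟩ := Alignment.exists_isMeasuring hmon hfin
  have hC := hB.toIsChain
  refine ⟨fun g hg => (Alignment.isUnipotent_of_mem_reps hC hg).mem_G hC, fun f hf => ?_⟩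
  obtain ⟨g, hg, h, hh, rfl⟩ := Alignment.exists_mem_reps hA hB hf
  refine ⟨g, ⟨hg, h, hh, rfl⟩, ?_⟩
  rintro g' ⟨hg', h', hh', e⟩
  refine Alignment.reps_unique hA hC hg hg' (mul_mem hh (inv_mem hh')) ?_
  rw [← mul_assoc, e, mul_inv_cancel_right]
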